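/- Let $\mathcal G\rightrightarrows M$ be a (finite-dimensional, smooth) Lie groupoid with source $\mathsf s$, target $\mathsf t$ and inversion $\mathrm{inv}$, and let $E=\mathrm{Lie}(\mathcal G)=\mathsf T\mathcal G|_M/\mathsf TM$ be its Lie algebroid, with anchor $\alpha$ induced by $\mathsf T\mathsf s-\mathsf T\mathsf t$. For a section $X$ of $E$ let $X^L$ and $X^R$ be the left- and right-invariant vector fields on $\mathcal G$ that represent $X$ along $M$; the bracket is given by $[X,Y]^L=[X^L,Y^L]$. Let $F:\mathcal G\to\mathbb R$ be a smooth function with $F|_M=0$ and $dF|_M=0$ (a contrast function), and let $g^F(X,Y)=X^LY^LF|_M$ be the induced symmetric 2-form on $E$, with kernel $K^F=\{X\in E: g^F(X,\cdot)=0\}$. Put $F^*=F\circ\mathrm{inv}$. Assume that $F$ is a Koszul contrast function: $K^F$ has constant rank, and $X^LY^LZ^RF|_M=0$ and $X^LY^LZ^RF^*|_M=0$ for all smooth sections $X,Y$ of $E$ and all smooth sections $Z$ of $K^F$. Assume moreover that $F=F^*$. Then $(E,g^F)$ is semi-Riemannian, i.e. $g^F$ is a smooth symmetric 2-form on $E$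 whose kernel has constant rank, and the following holds. 1. Let $g^{[F]}(\bar X,\bar Y)=g^F(X,Y)$ be the induced metric on $E/K^F$, where $\bar X$ is the class of $X$. There is a unique map $\nabla^F$, $(X,\sigma)\mapsto\nabla^F_X\sigma$, assigning to a section $X$ of $E$ and a section $\sigma$ of $E/K^F$ a section of $E/K^F$, with $g^{[F]}(\nabla^F_X\bar Y,\bar Z)=X^LY^LZ^RF|_M$ for all sections $X,Y,Z$ of $E$. It is the transversal Levi-Civita connection: it is an $E$-connection on $E/K^F$, it is torsion-free, $\nabla^F_X\bar Y-\nabla^F_Y\bar X=\overline{[X,Y]}$, and it is self-dual, $\alpha(X)\,g^{[F]}(\sigma,\tau)=g^{[F]}(\nabla^F_X\sigma,\tau)+g^{[F]}(\sigma,\nabla^F_X\tau)$. 2. Let $C\subset E$ be any smooth subbundle with $E=C\oplus K^F$. There is a unique map $D$, assigning to sections $X,Y$ of $E$ a section $D_XY$ of $C$, with $g^F(D_XY,Z)=X^LY^LZ^RF|_M$ for all sections $X,Y,Z$ of $E$ (that is, $D_XY=\nabla^F_XY$, with $E/K^F$ viewed as the subbundle $C$). This $D$ is a Koszul derivative on $(E,g^F)$: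 it is $\mathbb R$-bilinear and, for all sections $X,Y,Z,W$ of $E$ and all $f\in C^\infty(M)$, (a) $g^F(D_{fX}Z,W)=f\,g^F(D_XZ,W)$; (b) $g^F(D_X(fY),W)=\alpha(X)(f)\,g^F(Y,W)+f\,g^F(D_XY,W)$; (c) $\alpha(Z)\,g^F(X,Y)=g^F(D_ZX,Y)+g^F(X,D_ZY)$; (d) $g^F(D_XY,W)-g^F(D_YX,W)=g^F([X,Y],W)$. The transversal Levi-Civita connection corresponding to $D$ is $\nabla^F$: $\overline{D_XY}=\nabla^F_X\bar Y$. 3. In particular, a Koszul derivative on $(E,g^F)$ always exists. -/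

import Mathlib

open scoped Manifold ContDiff Topology

/-- A (finite-dimensional, smooth) Lie groupoid `G ⇉ M`. The value `mul g h` is only meaningful
for composable pairs, i.e. when `src g = tgt h`; nothing is required of it elsewhere. The set of
composable pairs is an embedded submanifold of `G × G`, and `ContMDiffOn` on it is smoothness of
the multiplication as a map on this submanifold. The inclusion `unit` of the units is
automatically an embedding, since it has the smooth left inverse `src`. -/
structure LieGroupoid
    (EM : Type*) [NormedAddCommGroup EM] [NormedSpace ℝ EM]
    (EG : Type*) [NormedAddCommGroup EG] [NormedSpace ℝ EG]
    (M : Type*) [TopologicalSpace M] [ChartedSpace EM M]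
    (G : Type*) [TopologicalSpace G] [ChartedSpace EG G] where
  src : G → M
  tgt : G → M
  unit : M → G
  mul : G → G → G
  inv : G → G
  src_unit : ∀ x, src (unit x) = x
  tgt_unit : ∀ x, tgt (unit x) = x
  src_mul : ∀ g h, src g = tgt h → src (mul g h) = src h
  tgt_mul : ∀ g h, src g = tgt h → tgt (mul g h) = tgt g
  mul_assoc : ∀ g h k, src g = tgt h → src h = tgt k → mul (mul g h) k = mul g (mul h k)
  unit_mul : ∀ g, mul (unit (tgt g)) g = g
  mul_unit : ∀ g, mul g (unit (src g)) = g
  src_inv : ∀ g, src (inv g) = tgt g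
  tgt_inv : ∀ g, tgt (inv g) = src g
  mul_inv : ∀ g, mul g (inv g) = unit (tgt g)
  inv_mul : ∀ g, mul (inv g) g = unit (src g)
  isSubmersion_src : Manifold.IsSubmersion 𝓘(ℝ, EG) 𝓘(ℝ, EM) ∞ src
  isSubmersion_tgt : Manifold.IsSubmersion 𝓘(ℝ, EG) 𝓘(ℝ, EM) ∞ tgt
  contMDiff_src : ContMDiff 𝓘(ℝ, EG) 𝓘(ℝ, EM) ∞ src
  contMDiff_tgt : ContMDiff 𝓘(ℝ, EG) 𝓘(ℝ, EM) ∞ tgt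
  contMDiff_unit : ContMDiff 𝓘(ℝ, EM) 𝓘(ℝ, EG) ∞ unit
  contMDiff_inv : ContMDiff 𝓘(ℝ, EG) 𝓘(ℝ, EG) ∞ inv
  contMDiffOn_mul : ContMDiffOn (𝓘(ℝ, EG).prod 𝓘(ℝ, EG)) 𝓘(ℝ, EG) ∞
    (fun p : G × G => mul p.1 p.2) {p : G × G | src p.1 = tgt p.2}

namespace LieGroupoid

noncomputable section

variable {EM : Type*} [NormedAddCommGroup EM] [NormedSpace ℝ EM]
  {EG : Type*} [NormedAddCommGroup EG] [NormedSpace ℝ EG]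
  {M : Type*} [TopologicalSpace M] [ChartedSpace EM M]
  {G : Type*} [TopologicalSpace G] [ChartedSpace EG G]

section Algebroid

variable (A : LieGroupoid EM EG M G)

/-- The differential of the source map at a unit, as a map `T_x G → T_x M`. -/
def dSrc (x : M) : TangentSpace 𝓘(ℝ, EG) (A.unit x) →ₗ[ℝ] TangentSpace 𝓘(ℝ, EM) x :=
  (mfderiv 𝓘(ℝ, EG) 𝓘(ℝ, EM) A.src (A.unit x)).toLinearMap

/-- The differential of the target map at a unit, as a map `T_x G → T_x M`. -/
def dTgt (x : M) : TangentSpace 𝓘(ℝ, EG) (A.unit x) →ₗ[ℝ] TangentSpace 𝓘(ℝ, EM) x :=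
  (mfderiv 𝓘(ℝ, EG) 𝓘(ℝ, EM) A.tgt (A.unit x)).toLinearMap

/-- The differential of the inclusion of the units. -/
def dUnit (x : M) : TangentSpace 𝓘(ℝ, EM) x →ₗ[ℝ] TangentSpace 𝓘(ℝ, EG) (A.unit x) :=
  (mfderiv 𝓘(ℝ, EM) 𝓘(ℝ, EG) A.unit x).toLinearMap

theorem dSrc_dUnit (x : M) (v : TangentSpace 𝓘(ℝ, EM) x) : A.dSrc x (A.dUnit x v) = v := by
  have h := mfderiv_comp x ((A.contMDiff_src (A.unit x)).mdifferentiableAt (by simp))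
    ((A.contMDiff_unit x).mdifferentiableAt (by simp))
  have e : A.src ∘ A.unit = id := funext A.src_unit
  rw [e, mfderiv_id] at h
  exact (congrArg (fun L => L v) h).symm

theorem dTgt_dUnit (x : M) (v : TangentSpace 𝓘(ℝ, EM) x) : A.dTgt x (A.dUnit x v) = v := by
  have h := mfderiv_comp x ((A.contMDiff_tgt (A.unit x)).mdifferentiableAt (by simp))
    ((A.contMDiff_unit x).mdifferentiableAt (by simp))
  have e : A.tgt ∘ A.unit = id := funext A.tgt_unit
  rw [e, mfderiv_id] at h
  exact (congrArg (fun L => L v) h).symm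

/-- The fibre at `x` of the Lie algebroid `Lie(G) = TG|_M / TM`. -/
abbrev Fiber (x : M) : Type _ :=
  TangentSpace 𝓘(ℝ, EG) (A.unit x) ⧸ LinearMap.range (A.dUnit x)

/-- The class in the normal bundle of a vector tangent to `G` at a unit. -/
def toFiber (x : M) : TangentSpace 𝓘(ℝ, EG) (A.unit x) →ₗ[ℝ] A.Fiber x :=
  (LinearMap.range (A.dUnit x)).mkQ

/-- The unique representative of an element of `Lie(G)_x` that is tangent to the target fibre. -/
def leftRep (x : M) : A.Fiber x →ₗ[ℝ] TangentSpace 𝓘(ℝ, EG) (A.unit x) :=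
  (LinearMap.range (A.dUnit x)).liftQ (LinearMap.id - A.dUnit x ∘ₗ A.dTgt x) (by
    rintro _ ⟨v, rfl⟩
    simp [LinearMap.mem_ker, A.dTgt_dUnit x v])

/-- The unique representative of an element of `Lie(G)_x` that is tangent to the source fibre. -/
def rightRep (x : M) : A.Fiber x →ₗ[ℝ] TangentSpace 𝓘(ℝ, EG) (A.unit x) :=
  (LinearMap.range (A.dUnit x)).liftQ (LinearMap.id - A.dUnit x ∘ₗ A.dSrc x) (by
    rintro _ ⟨v, rfl⟩
    simp [LinearMap.mem_ker, A.dSrc_dUnit x v])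

/-- The anchor of `Lie(G)`, induced by `T src - T tgt`. -/
def anchor (x : M) : A.Fiber x →ₗ[ℝ] TangentSpace 𝓘(ℝ, EM) x :=
  (LinearMap.range (A.dUnit x)).liftQ (A.dSrc x - A.dTgt x) (by
    rintro _ ⟨v, rfl⟩
    simp [LinearMap.mem_ker, A.dSrc_dUnit x v, A.dTgt_dUnit x v])

end Algebroid

section Sections

variable [IsManifold 𝓘(ℝ, EG) ∞ G] (A : LieGroupoid EM EG M G)

/-- A smooth vector field on `G` along the units. -/
def IsSmoothAlong (V : ∀ x : M, TangentSpace 𝓘(ℝ, EG) (A.unit x)) : Prop :=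
  ContMDiff 𝓘(ℝ, EM) (𝓘(ℝ, EG).prod 𝓘(ℝ, EG)) ∞
    (fun x => (⟨A.unit x, V x⟩ : TangentBundle 𝓘(ℝ, EG) G))

theorem isSmoothAlong_iff (V : ∀ x : M, TangentSpace 𝓘(ℝ, EG) (A.unit x)) :
    A.IsSmoothAlong V ↔ ∀ x₀, ContMDiffAt 𝓘(ℝ, EM) 𝓘(ℝ, EG) ∞
      (fun x => (trivializationAt EG (TangentSpace 𝓘(ℝ, EG)) (A.unit x₀)).linearMapAt ℝ
        (A.unit x) (V x)) x₀ := by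
  refine forall_congr' fun x₀ => ?_
  rw [Bundle.contMDiffAt_totalSpace]
  have hev : ∀ᶠ x in 𝓝 x₀,
      A.unit x ∈ (trivializationAt EG (TangentSpace 𝓘(ℝ, EG)) (A.unit x₀)).baseSet :=
    A.contMDiff_unit.continuous.continuousAt.eventually
      ((trivializationAt EG (TangentSpace 𝓘(ℝ, EG)) (A.unit x₀)).open_baseSet.mem_nhds
        (FiberBundle.mem_baseSet_trivializationAt' _))
  constructor
  · rintro ⟨-, h⟩
    refine h.congr_of_eventuallyEq ?_
    filter_upwards [hev] with x hx
    rw [Bundle.Trivialization.coe_linearMapAt_of_mem _ hx]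
  · intro h
    refine ⟨A.contMDiff_unit x₀, h.congr_of_eventuallyEq ?_⟩
    filter_upwards [hev] with x hx
    rw [Bundle.Trivialization.coe_linearMapAt_of_mem _ hx]

theorem IsSmoothAlong.add {A : LieGroupoid EM EG M G}
    {V W : ∀ x : M, TangentSpace 𝓘(ℝ, EG) (A.unit x)}
    (hV : A.IsSmoothAlong V) (hW : A.IsSmoothAlong W) : A.IsSmoothAlong (V + W) := by
  rw [isSmoothAlong_iff] at *
  intro x₀
  exact ((hV x₀).add (hW x₀)).congr_of_eventuallyEq (.of_forall fun x => by simp)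

theorem IsSmoothAlong.smul {A : LieGroupoid EM EG M G}
    {V : ∀ x : M, TangentSpace 𝓘(ℝ, EG) (A.unit x)} (hV : A.IsSmoothAlong V)
    {f : M → ℝ} (hf : ContMDiff 𝓘(ℝ, EM) 𝓘(ℝ, ℝ) ∞ f) :
    A.IsSmoothAlong (fun x => f x • V x) := by
  rw [isSmoothAlong_iff] at *
  intro x₀
  exact ((hf x₀).smul (hV x₀)).congr_of_eventuallyEq (.of_forall fun x => by simp)

theorem isSmoothAlong_zero : A.IsSmoothAlong 0 := by
  rw [isSmoothAlong_iff]
  intro x₀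
  simpa using contMDiffAt_const

/-- The space of smooth sections of `Lie(G)`: those sections of `TG|_M / TM` that are represented
by a smooth vector field on `G` along the units. -/
def Sec : Submodule ℝ (∀ x : M, A.Fiber x) where
  carrier := {X | ∃ V : ∀ x : M, TangentSpace 𝓘(ℝ, EG) (A.unit x),
    A.IsSmoothAlong V ∧ ∀ x, A.toFiber x (V x) = X x}
  zero_mem' := ⟨0, A.isSmoothAlong_zero, fun x => map_zero _⟩
  add_mem' := by
    rintro X Y ⟨V, hV, hVX⟩ ⟨W, hW, hWY⟩
    exact ⟨V + W, hV.add hW, fun x => by simp [hVX, hWY]⟩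
  smul_mem' := by
    rintro c X ⟨V, hV, hVX⟩
    exact ⟨fun x => c • V x, hV.smul contMDiff_const, fun x => by simp [hVX]⟩

/-- The product `f X` of a smooth function on `M` and a section of `Lie(G)`. -/
def fmul (f : C^∞⟮𝓘(ℝ, EM), M; 𝓘(ℝ, ℝ), ℝ⟯) (X : A.Sec) : A.Sec :=
  ⟨fun x => f x • X.1 x, by
    obtain ⟨V, hV, hVX⟩ := X.2
    exact ⟨fun x => f x • V x, hV.smul f.contMDiff, fun x => by simp [hVX]⟩⟩

/-- The left-invariant vector field `X^L` on `G`: its value at `g` is the image of the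
representative of `X` at the unit of `src g` that is tangent to the target fibre, under the
differential of the left translation by `g`, which is defined on the target fibre of `src g`. -/
def left (X : A.Sec) (g : G) : TangentSpace 𝓘(ℝ, EG) g :=
  mfderivWithin 𝓘(ℝ, EG) 𝓘(ℝ, EG) (fun h => A.mul g h) {h | A.tgt h = A.src g}
    (A.unit (A.src g)) (A.leftRep (A.src g) (X.1 (A.src g)))

/-- The right-invariant vector field `X^R` on `G`: its value at `g` is the image of the
representative of `X` at the unit of `tgt g` that is tangent to the source fibre, under the
differential of the right translation by `g`, which is defined on the source fibre of `tgt g`. -/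
def right (X : A.Sec) (g : G) : TangentSpace 𝓘(ℝ, EG) g :=
  mfderivWithin 𝓘(ℝ, EG) 𝓘(ℝ, EG) (fun h => A.mul h g) {h | A.src h = A.tgt g}
    (A.unit (A.tgt g)) (A.rightRep (A.tgt g) (X.1 (A.tgt g)))

/-- The bracket of sections of `Lie(G)`, determined by `[X, Y]^L = [X^L, Y^L]`. -/
def bracket (X Y : A.Sec) (x : M) : A.Fiber x :=
  A.toFiber x (VectorField.mlieBracket 𝓘(ℝ, EG) (A.left X) (A.left Y) (A.unit x))

/-- The derivative `α(X) f` of a function on the base in the direction of a section. -/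
def anchorDeriv (X : A.Sec) (f : M → ℝ) (x : M) : ℝ :=
  mfderiv 𝓘(ℝ, EM) 𝓘(ℝ, ℝ) f x (A.anchor x (X.1 x))

end Sections

/-- The derivative `V f` of a function on `G` along a vector field. -/
def dirDeriv (V : ∀ g : G, TangentSpace 𝓘(ℝ, EG) g) (f : G → ℝ) (g : G) : ℝ :=
  mfderiv 𝓘(ℝ, EG) 𝓘(ℝ, ℝ) f g (V g)

section Metric

variable (A : LieGroupoid EM EG M G)

/-- A family of symmetric bilinear forms on the fibres of `Lie(G)`. -/
structure SymForm where
  form : ∀ x : M, LinearMap.BilinForm ℝ (A.Fiber x)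
  symm : ∀ x e e', form x e e' = form x e' e

variable {A}

namespace SymForm

variable (b : A.SymForm)

/-- The kernel of the form, in the fibre at `x`. -/
def kernel (x : M) : Submodule ℝ (A.Fiber x) := LinearMap.ker (b.form x)

/-- The fibre at `x` of the quotient `Lie(G) / K` by the kernel `K` of the form. -/
abbrev QuotFiber (x : M) : Type _ := A.Fiber x ⧸ b.kernel x

/-- The induced (transversal) form on the quotient `Lie(G) / K`. -/
def transversal (x : M) : LinearMap.BilinForm ℝ (b.QuotFiber x) :=
  (b.kernel x).liftQ
    { toFun := fun e => (b.kernel x).liftQ (b.form x e) (by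
        intro e' he'
        have h : b.form x e' = 0 := he'
        rw [LinearMap.mem_ker, b.symm, h, LinearMap.zero_apply])
      map_add' := fun e e' => by
        ext
        simp
      map_smul' := fun c e => by
        ext
        simp } (by
    intro e he
    have h : b.form x e = 0 := he
    rw [LinearMap.mem_ker]
    ext
    simp [h])

@[simp] theorem transversal_mk (x : M) (e e' : A.Fiber x) :
    b.transversal x ((b.kernel x).mkQ e) ((b.kernel x).mkQ e') = b.form x e e' := rfl

variable [IsManifold 𝓘(ℝ, EG) ∞ G]

/-- The form is smooth and its kernel has constant rank. -/
structure IsSemiRiemannian : Prop where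
  smooth : ∀ X Y : A.Sec, ContMDiff 𝓘(ℝ, EM) 𝓘(ℝ, ℝ) ∞ (fun x => b.form x (X.1 x) (Y.1 x))
  constant_rank : ∃ r : ℕ, ∀ x, Module.finrank ℝ (b.kernel x) = r

/-- Koszul derivatives on the Lie algebroid `Lie(G)` with the form `b`. -/
structure IsKoszulDerivative (D : A.Sec → A.Sec → A.Sec) : Prop where
  add_left : ∀ X X' Y, D (X + X') Y = D X Y + D X' Y
  smul_left : ∀ (c : ℝ) X Y, D (c • X) Y = c • D X Y
  add_right : ∀ X Y Y', D X (Y + Y') = D X Y + D X Y'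
  smul_right : ∀ (c : ℝ) X Y, D X (c • Y) = c • D X Y
  tensorial : ∀ (f : C^∞⟮𝓘(ℝ, EM), M; 𝓘(ℝ, ℝ), ℝ⟯) (X Z W : A.Sec) (x : M),
    b.form x ((D (A.fmul f X) Z).1 x) (W.1 x) = f x * b.form x ((D X Z).1 x) (W.1 x)
  leibniz : ∀ (f : C^∞⟮𝓘(ℝ, EM), M; 𝓘(ℝ, ℝ), ℝ⟯) (X Y W : A.Sec) (x : M),
    b.form x ((D X (A.fmul f Y)).1 x) (W.1 x) =
      A.anchorDeriv X f x * b.form x (Y.1 x) (W.1 x) + f x * b.form x ((D X Y).1 x) (W.1 x)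
  metric : ∀ (X Y Z : A.Sec) (x : M),
    A.anchorDeriv Z (fun y => b.form y (X.1 y) (Y.1 y)) x =
      b.form x ((D Z X).1 x) (Y.1 x) + b.form x (X.1 x) ((D Z Y).1 x)
  torsionFree : ∀ (X Y W : A.Sec) (x : M),
    b.form x ((D X Y).1 x) (W.1 x) - b.form x ((D Y X).1 x) (W.1 x) =
      b.form x (A.bracket X Y x) (W.1 x)

/-- The map sending a section of `Lie(G)` to the associated section of `Lie(G) / K`. -/
def quotMap : A.Sec →ₗ[ℝ] ∀ x : M, b.QuotFiber x where
  toFun X x := (b.kernel x).mkQ (X.1 x)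
  map_add' _ _ := rfl
  map_smul' _ _ := rfl

/-- The space of smooth sections of `Lie(G) / K`. -/
def QuotSec : Submodule ℝ (∀ x : M, b.QuotFiber x) := LinearMap.range b.quotMap

/-- The smooth section of `Lie(G) / K` represented by a section of `Lie(G)`. -/
def bar (X : A.Sec) : b.QuotSec := ⟨b.quotMap X, X, rfl⟩

/-- The product of a smooth function on `M` and a section of `Lie(G) / K`. -/
def quotFmul (f : C^∞⟮𝓘(ℝ, EM), M; 𝓘(ℝ, ℝ), ℝ⟯) (σ : b.QuotSec) : b.QuotSec :=
  ⟨fun x => f x • σ.1 x, by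
    obtain ⟨Y, hY⟩ := σ.2
    exact ⟨A.fmul f Y, by rw [← hY]; rfl⟩⟩

/-- `Lie(G)`-connections on the vector bundle `Lie(G) / K`. -/
structure IsConnection (nabla : A.Sec → b.QuotSec → b.QuotSec) : Prop where
  add_left : ∀ X X' σ, nabla (X + X') σ = nabla X σ + nabla X' σ
  smul_left : ∀ (c : ℝ) X σ, nabla (c • X) σ = c • nabla X σ
  add_right : ∀ X σ τ, nabla X (σ + τ) = nabla X σ + nabla X τ
  smul_right : ∀ (c : ℝ) X σ, nabla X (c • σ) = c • nabla X σ
  tensorial : ∀ (f : C^∞⟮𝓘(ℝ, EM), M; 𝓘(ℝ, ℝ), ℝ⟯) (X : A.Sec) (σ : b.QuotSec),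
    nabla (A.fmul f X) σ = b.quotFmul f (nabla X σ)
  leibniz : ∀ (f : C^∞⟮𝓘(ℝ, EM), M; 𝓘(ℝ, ℝ), ℝ⟯) (X : A.Sec) (σ : b.QuotSec) (x : M),
    (nabla X (b.quotFmul f σ)).1 x = f x • (nabla X σ).1 x + A.anchorDeriv X f x • σ.1 x

/-- Transversal Levi-Civita connections: torsion-free `Lie(G)`-connections on `Lie(G) / K` that
are self-dual with respect to the transversal metric. -/
structure IsTransversalLeviCivita (nabla : A.Sec → b.QuotSec → b.QuotSec) : Prop where
  isConnection : b.IsConnection nabla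
  torsionFree : ∀ (X Y : A.Sec) (x : M),
    (nabla X (b.bar Y)).1 x - (nabla Y (b.bar X)).1 x = (b.kernel x).mkQ (A.bracket X Y x)
  selfDual : ∀ (X : A.Sec) (σ τ : b.QuotSec) (x : M),
    A.anchorDeriv X (fun y => b.transversal y (σ.1 y) (τ.1 y)) x =
      b.transversal x ((nabla X σ).1 x) (τ.1 x) + b.transversal x (σ.1 x) ((nabla X τ).1 x)

end SymForm

end Metric

section Subbundle

variable [IsManifold 𝓘(ℝ, EG) ∞ G] (A : LieGroupoid EM EG M G)

/-- A family of subspaces of the fibres is a smooth subbundle of `Lie(G)` if it has constant rank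
and is spanned by its smooth sections. -/
structure IsSubbundle (C : ∀ x : M, Submodule ℝ (A.Fiber x)) : Prop where
  constant_rank : ∃ r : ℕ, ∀ x, Module.finrank ℝ (C x) = r
  exists_section : ∀ x, ∀ e ∈ C x, ∃ X : A.Sec, X.1 x = e ∧ ∀ y, X.1 y ∈ C y

end Subbundle

section Contrast

variable (A : LieGroupoid EM EG M G)

/-- Contrast functions on a Lie groupoid. -/
structure ContrastFunction where
  toFun : G → ℝ
  contMDiff : ContMDiff 𝓘(ℝ, EG) 𝓘(ℝ, ℝ) ∞ toFun
  map_unit : ∀ x, toFun (A.unit x) = 0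
  mfderiv_unit : ∀ x, mfderiv 𝓘(ℝ, EG) 𝓘(ℝ, ℝ) toFun (A.unit x) = 0

variable {A}

namespace ContrastFunction

variable (F : A.ContrastFunction)

/-- The second derivative of `F` at a unit in the preferred chart: `hess x u v` is `U (V F)` at
this unit, for the vector fields `U`, `V` with constant coordinates `u`, `v` in this chart. -/
def hess (x : M) : LinearMap.BilinForm ℝ (TangentSpace 𝓘(ℝ, EG) (A.unit x)) :=
  ContinuousLinearMap.toBilinForm (𝕜 := ℝ) (E := EG)
    (fderiv ℝ (fderiv ℝ (F.toFun ∘ (extChartAt 𝓘(ℝ, EG) (A.unit x)).symm))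
      (extChartAt 𝓘(ℝ, EG) (A.unit x) (A.unit x)))

variable [IsManifold 𝓘(ℝ, EG) ∞ G]

theorem contDiffAt_chart (x : M) :
    ContDiffAt ℝ ∞ (F.toFun ∘ (extChartAt 𝓘(ℝ, EG) (A.unit x)).symm)
      (extChartAt 𝓘(ℝ, EG) (A.unit x) (A.unit x)) := by
  rw [← contMDiffAt_iff_contDiffAt]
  refine (F.contMDiff _).comp _ ?_
  exact (contMDiffOn_extChartAt_symm (A.unit x)).contMDiffAt
    (extChartAt_target_mem_nhds (I := 𝓘(ℝ, EG)) (A.unit x))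

theorem hess_symm (x : M) (u v : TangentSpace 𝓘(ℝ, EG) (A.unit x)) :
    F.hess x u v = F.hess x v u :=
  (F.contDiffAt_chart x).isSymmSndFDerivAt
    (by
      simpa using! (WithTop.coe_le_coe.2 le_top : ((2 : ℕ∞) : WithTop ℕ∞) ≤ ((⊤ : ℕ∞) : WithTop ℕ∞))) u v

/-- The pseudometric `g^F` on `Lie(G)`: `g^F(X, Y) = U (V F)` at the units, for vector fields `U`,
`V` on `G` representing `X`, `Y`; see `metric_toFiber`. -/
def metric : A.SymForm where
  form x := (F.hess x).compl₁₂ (A.leftRep x) (A.leftRep x)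
  symm x _ _ := F.hess_symm x _ _

theorem dirDeriv_dirDeriv_eq_hess (x : M) (U V : ∀ g : G, TangentSpace 𝓘(ℝ, EG) g)
    (hV : MDifferentiableAt 𝓘(ℝ, EG) (𝓘(ℝ, EG).prod 𝓘(ℝ, EG))
      (fun g => (⟨g, V g⟩ : TangentBundle 𝓘(ℝ, EG) G)) (A.unit x)) :
    dirDeriv U (dirDeriv V F.toFun) (A.unit x) = F.hess x (U (A.unit x)) (V (A.unit x)) := by
  set p := A.unit x with hp
  set φ := extChartAt 𝓘(ℝ, EG) p with hφ
  set f : EG → ℝ := F.toFun ∘ φ.symm with hf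
  have hfp : ContDiffAt ℝ ∞ f (φ p) := F.contDiffAt_chart x
  let c : G → EG := fun g => (trivializationAt EG (TangentSpace 𝓘(ℝ, EG)) p ⟨g, V g⟩).2
  have hc : MDifferentiableAt 𝓘(ℝ, EG) 𝓘(ℝ, EG) c p :=
    ((mdifferentiableAt_totalSpace _ _).1 hV).2
  have hsrc : ∀ᶠ g in 𝓝 p, g ∈ (chartAt EG p).source := chart_source_mem_nhds EG p
  have hcg : ∀ g ∈ (chartAt EG p).source, c g = mfderiv 𝓘(ℝ, EG) 𝓘(ℝ, EG) φ g (V g) := by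
    intro g hg
    exact (congrFun (Bundle.Trivialization.coe_linearMapAt_of_mem (R := ℝ)
      (trivializationAt EG (TangentSpace 𝓘(ℝ, EG)) p) (by simpa using hg)) (V g)).symm.trans
      (congrArg (fun L => L (V g))
        (TangentBundle.continuousLinearMapAt_trivializationAt (I := 𝓘(ℝ, EG)) hg))
  have hφp : mfderiv 𝓘(ℝ, EG) 𝓘(ℝ, EG) φ p = ContinuousLinearMap.id ℝ _ :=
    mfderiv_extChartAt_self
  have hcp : c p = V p := by
    rw [hcg p (mem_chart_source EG p), hφp]; rfl
  have hfg : ∀ g ∈ (chartAt EG p).source, ∀ᶠ h in 𝓝 g, F.toFun h = (f ∘ φ) h := by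
    intro g hg
    filter_upwards [(chartAt EG p).open_source.mem_nhds hg] with h hh
    simp only [hf, Function.comp_apply]
    rw [φ.left_inv (by simpa [hφ] using hh)]
  have hsm : ContMDiffOn 𝓘(ℝ, EG) 𝓘(ℝ, ℝ) ∞ f φ.target :=
    F.contMDiff.comp_contMDiffOn (contMDiffOn_extChartAt_symm p)
  have hVF : ∀ g ∈ (chartAt EG p).source, dirDeriv V F.toFun g = fderiv ℝ f (φ g) (c g) := by
    intro g hg
    have hg' : g ∈ φ.source := by simpa [hφ] using hg
    have hd : DifferentiableAt ℝ f (φ g) :=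
      ((hsm.contDiffOn.contDiffAt ((isOpen_extChartAt_target p).mem_nhds
        (φ.map_source hg'))).differentiableAt (by simp))
    have := mfderiv_comp g hd.mdifferentiableAt (mdifferentiableAt_extChartAt (I := 𝓘(ℝ, EG)) hg)
    rw [dirDeriv, Filter.EventuallyEq.mfderiv_eq (hfg g hg), this, hcg g hg, mfderiv_eq_fderiv]
    rfl
  let k : EG → ℝ := fun z => fderiv ℝ f z (c (φ.symm z))
  have hk : HasFDerivAt k (((fderiv ℝ f (φ p)).comp (fderiv ℝ (c ∘ φ.symm) (φ p))) +
      (fderiv ℝ (fderiv ℝ f) (φ p)).flip (c (φ.symm (φ p)))) (φ p) := by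
    have h1 : DifferentiableAt ℝ (fderiv ℝ f) (φ p) :=
      (hfp.fderiv_right (m := 1) (by norm_cast)).differentiableAt (by simp)
    have h2 : DifferentiableAt ℝ (c ∘ φ.symm) (φ p) := by
      rw [← mdifferentiableAt_iff_differentiableAt]
      refine MDifferentiableAt.comp (I' := 𝓘(ℝ, EG)) _ ?_ ?_
      · rwa [extChartAt_to_inv]
      · exact ((contMDiffOn_extChartAt_symm (n := ∞) p).contMDiffAt
          (extChartAt_target_mem_nhds (I := 𝓘(ℝ, EG)) p)).mdifferentiableAt (by simp)
    exact h1.hasFDerivAt.clm_apply h2.hasFDerivAt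
  have hf0 : fderiv ℝ f (φ p) = 0 := by
    have h := mfderiv_comp p (hfp.differentiableAt (by simp)).mdifferentiableAt
      (mdifferentiableAt_extChartAt (I := 𝓘(ℝ, EG)) (mem_chart_source EG p))
    rw [← Filter.EventuallyEq.mfderiv_eq (hfg p (mem_chart_source EG p)), F.mfderiv_unit x,
      hφp, mfderiv_eq_fderiv] at h
    exact h.symm
  have hkφ : ∀ᶠ g in 𝓝 p, dirDeriv V F.toFun g = (k ∘ φ) g := by
    filter_upwards [hsrc] with g hg
    rw [hVF g hg]
    simp only [k, Function.comp_apply]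
    rw [φ.left_inv (by simpa [hφ] using hg)]
  have h := mfderiv_comp p hk.differentiableAt.mdifferentiableAt
    (mdifferentiableAt_extChartAt (I := 𝓘(ℝ, EG)) (mem_chart_source EG p))
  rw [dirDeriv, Filter.EventuallyEq.mfderiv_eq hkφ, h, hφp, mfderiv_eq_fderiv, hk.fderiv, hf0,
    extChartAt_to_inv, hcp]
  simp
  rfl

theorem hess_dUnit (x : M) (u : TangentSpace 𝓘(ℝ, EM) x) : F.hess x (A.dUnit x u) = 0 := by
  set p := A.unit x with hp
  set φ := extChartAt 𝓘(ℝ, EG) p with hφ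
  set f : EG → ℝ := F.toFun ∘ φ.symm with hf
  have hfp : ContDiffAt ℝ ∞ f (φ p) := F.contDiffAt_chart x
  have h1 : DifferentiableAt ℝ (fderiv ℝ f) (φ p) :=
    (hfp.fderiv_right (m := 1) (by norm_cast)).differentiableAt (by simp)
  have h2 : MDifferentiableAt 𝓘(ℝ, EM) 𝓘(ℝ, EG) A.unit x :=
    (A.contMDiff_unit x).mdifferentiableAt (by simp)
  have hzero : ∀ᶠ y in 𝓝 x, (fderiv ℝ f ∘ φ ∘ A.unit) y = 0 := by
    have hev : ∀ᶠ y in 𝓝 x, A.unit y ∈ φ.source :=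
      A.contMDiff_unit.continuous.continuousAt.eventually
        ((isOpen_extChartAt_source (I := 𝓘(ℝ, EG)) p).mem_nhds (mem_extChartAt_source p))
    filter_upwards [hev] with y hy
    have hs : MDifferentiableAt 𝓘(ℝ, EG) 𝓘(ℝ, EG) φ.symm (φ (A.unit y)) :=
      ((contMDiffOn_extChartAt_symm (n := ∞) p).contMDiffAt
        ((isOpen_extChartAt_target p).mem_nhds (φ.map_source hy))).mdifferentiableAt (by simp)
    have h := mfderiv_comp (φ (A.unit y)) ((F.contMDiff _).mdifferentiableAt (by simp)) hs
    rw [φ.left_inv hy, F.mfderiv_unit, mfderiv_eq_fderiv] at h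
    exact h.trans (ContinuousLinearMap.zero_comp _)
  have hφ1 : MDifferentiableAt 𝓘(ℝ, EG) 𝓘(ℝ, EG) φ (A.unit x) :=
    mdifferentiableAt_extChartAt (mem_chart_source EG p)
  have h := mfderiv_comp x h1.mdifferentiableAt (hφ1.comp x h2)
  have hφp : mfderiv 𝓘(ℝ, EG) 𝓘(ℝ, EG) φ (A.unit x) = ContinuousLinearMap.id ℝ _ :=
    mfderiv_extChartAt_self
  rw [Filter.EventuallyEq.mfderiv_eq (f := fun _ => (0 : EG →L[ℝ] ℝ)) hzero, mfderiv_const,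
    mfderiv_comp x hφ1 h2, hφp, mfderiv_eq_fderiv] at h
  exact LinearMap.ext fun v => (congrArg (fun L : EM →L[ℝ] EG →L[ℝ] ℝ => L u v) h).symm

/-- `g^F(X, Y) = U (V F)` for all vector fields `U`, `V` on `G` representing `X`, `Y`. -/
theorem metric_toFiber (x : M) (U V : ∀ g : G, TangentSpace 𝓘(ℝ, EG) g)
    (hV : MDifferentiableAt 𝓘(ℝ, EG) (𝓘(ℝ, EG).prod 𝓘(ℝ, EG))
      (fun g => (⟨g, V g⟩ : TangentBundle 𝓘(ℝ, EG) G)) (A.unit x)) :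
    F.metric.form x (A.toFiber x (U (A.unit x))) (A.toFiber x (V (A.unit x))) =
      dirDeriv U (dirDeriv V F.toFun) (A.unit x) := by
  have key : ∀ u v : TangentSpace 𝓘(ℝ, EG) (A.unit x),
      F.metric.form x (A.toFiber x u) (A.toFiber x v) = F.hess x u v := by
    intro u v
    change F.hess x (u - A.dUnit x (A.dTgt x u)) (v - A.dUnit x (A.dTgt x v)) = F.hess x u v
    rw [map_sub, F.hess_symm x _ (A.dUnit x _), hess_dUnit, LinearMap.zero_apply, sub_zero, map_sub,
      hess_dUnit, sub_zero]
  rw [key, F.dirDeriv_dirDeriv_eq_hess x U V hV]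

/-- The function `X^L Y^L Z^R f` on the units. -/
def leftLeftRight (X Y Z : A.Sec) (f : G → ℝ) (x : M) : ℝ :=
  dirDeriv (A.left X) (dirDeriv (A.left Y) (dirDeriv (A.right Z) f)) (A.unit x)

/-- Koszul contrast functions: regular contrast functions `F` such that `X^L Y^L Z^R F` and
`X^L Y^L Z^R F*`, where `F* = F ∘ inv`, vanish on the units for all sections `X`, `Y` of `Lie(G)`
and all sections `Z` of the kernel of `g^F`. -/
structure IsKoszul : Prop where
  regular : ∃ r : ℕ, ∀ x, Module.finrank ℝ (F.metric.kernel x) = r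
  vanish : ∀ X Y Z : A.Sec, (∀ x, Z.1 x ∈ F.metric.kernel x) → ∀ x,
    leftLeftRight X Y Z F.toFun x = 0
  vanish_dual : ∀ X Y Z : A.Sec, (∀ x, Z.1 x ∈ F.metric.kernel x) → ∀ x,
    leftLeftRight X Y Z (F.toFun ∘ A.inv) x = 0

/-- `D X Y` represents `∇^F_X Y`, i.e. `g^F(D X Y, Z) = X^L Y^L Z^R F` on the units. -/
def Represents (D : A.Sec → A.Sec → A.Sec) : Prop :=
  ∀ (X Y Z : A.Sec) (x : M),
    F.metric.form x ((D X Y).1 x) (Z.1 x) = leftLeftRight X Y Z F.toFun x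

/-- The operator `∇^F` on sections of `Lie(G) / K`: the transversal metric of `∇_X` applied to the
class of `Y` and of the class of `Z` is `X^L Y^L Z^R F` on the units. -/
def IsKoszulConnection (nabla : A.Sec → F.metric.QuotSec → F.metric.QuotSec) : Prop :=
  ∀ (X Y Z : A.Sec) (x : M),
    F.metric.transversal x ((nabla X (F.metric.bar Y)).1 x) ((F.metric.bar Z).1 x) =
      leftLeftRight X Y Z F.toFun x

end ContrastFunction
end Contrast

end

end LieGroupoid

/-! Write T(X,Y,Z) for `X^L Y^L Z^R F` on the units. Everything follows from how T behaves in each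
slot. It is function-linear in X. It is function-linear in Z because `(hZ)^R = (h ∘ tgt) Z^R` and
left-invariant fields annihilate pullbacks under `tgt` (`leftLeftRight_fmul_right`). In Y it
satisfies a Leibniz rule whose extra term is `α(X)h` times `Y^L Z^R F`. Since dF vanishes along M,
the Hessian of F is well defined there and kills TM, so left and right representatives may be mixed
and `Y^L Z^R F` is g^F(Y,Z) (`metric_eq`).

Torsion: `X^L Y^L - Y^L X^L` acts as `[X,Y]^L`, so T(X,Y,Z) - T(Y,X,Z) = g^F([X,Y],Z)
(`metric_bracket`). Self-duality: on the units α(X) is `X^L - X^R`, left fields commute with right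
fields, and inversion exchanges the two kinds up to sign. For F = F* this gives α(X) g^F(Y,Z) =
T(X,Y,Z) + T(X,Z,Y) (`leftLeftRight_add_swap`).

By the Koszul condition T vanishes for Z in K^F. Duality then makes it vanish for Y in K^F as well
(`leftLeftRight_mid_mem_kernel`), so T depends on Y only through its class. It remains to represent
the one-form T(X,Y,·), which vanishes on the kernel, by a smooth section (`IsTensorial.exists_sec`):
constant rank lets the Gram matrix of a local frame of a complement be inverted smoothly, and the
affine spaces of solutions are patched by a partition of unity.

Inside a complement C the representing section is unique, hence D is bilinear. For bare existence of
a Koszul derivative a real-linear choice of representatives of classes suffices.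

Multiplication is smooth only on composable pairs, so identities between invariant fields are
checked on velocities of curves inside source and target fibres. -/

/-! ### Velocities of curves and local retractions of submersions. -/

section Velocity

variable {E : Type*} [NormedAddCommGroup E] [NormedSpace ℝ E]
  {E' : Type*} [NormedAddCommGroup E'] [NormedSpace ℝ E']
  {N : Type*} [TopologicalSpace N] [ChartedSpace E N]
  {N' : Type*} [TopologicalSpace N'] [ChartedSpace E' N']

/-- The curve `k` passes through `p` at time `0` with velocity `v`. -/
def HasVelocity (k : ℝ → N) (p : N) (v : TangentSpace 𝓘(ℝ, E) p) : Prop :=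
  k 0 = p ∧ HasMFDerivAt 𝓘(ℝ, ℝ) 𝓘(ℝ, E) k 0 (ContinuousLinearMap.toSpanSingleton ℝ (M₁ := E) v)

theorem HasMFDerivAt.hasVelocity {k : ℝ → N}
    {L : TangentSpace 𝓘(ℝ, ℝ) (0 : ℝ) →L[ℝ] TangentSpace 𝓘(ℝ, E) (k 0)}
    (h : HasMFDerivAt 𝓘(ℝ, ℝ) 𝓘(ℝ, E) k 0 L) : HasVelocity k (k 0) (L (1 : ℝ)) :=
  ⟨rfl, h.congr_mfderiv (ContinuousLinearMap.ext_ring (R₁ := ℝ) (M₁ := E)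
    (ContinuousLinearMap.toSpanSingleton_apply_one (M₁ := E) ℝ _).symm)⟩

namespace HasVelocity

variable {k k' : ℝ → N} {p : N} {v w : TangentSpace 𝓘(ℝ, E) p}

/-- The working tool for identities between tangent vectors: one curve is exhibited with both
vectors as its velocity. -/
theorem unique (h : HasVelocity k p v) (h' : HasVelocity k p w) : v = w := by
  obtain ⟨rfl, h⟩ := h
  obtain ⟨-, h'⟩ := h'
  have := congrArg (fun L : ℝ →L[ℝ] E => L 1) (hasMFDerivAt_unique h h')
  exact (ContinuousLinearMap.toSpanSingleton_apply_one (M₁ := E) ℝ v).symm.trans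
    (this.trans (ContinuousLinearMap.toSpanSingleton_apply_one (M₁ := E) ℝ w))

/-- The vector is typed in the model space, so that it can be moved between base points that are
equal only propositionally. -/
theorem base {v : E} {q : N} (h : HasVelocity k p v) (e : p = q) : HasVelocity k q v := by
  subst e
  exact h

theorem congr (h : HasVelocity k p v) (hk : ∀ᶠ t in 𝓝 0, k' t = k t) : HasVelocity k' p v := by
  obtain ⟨rfl, h⟩ := h
  have h0 : k' 0 = k 0 := hk.self_of_nhds
  refine ⟨h0, ?_⟩
  have := h.congr_of_eventuallyEq hk
  convert this using 1

theorem comp (h : HasVelocity k p v) {f : N → N'}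
    {f' : TangentSpace 𝓘(ℝ, E) p →L[ℝ] TangentSpace 𝓘(ℝ, E') (f p)}
    (hf : HasMFDerivAt 𝓘(ℝ, E) 𝓘(ℝ, E') f p f') :
    HasVelocity (f ∘ k) (f p) (f' v) := by
  obtain ⟨rfl, h⟩ := h
  have := (hf.comp 0 h).hasVelocity
  exact (congrArg (fun u => HasVelocity (f ∘ k) (f (k 0)) (f' u))
    (ContinuousLinearMap.toSpanSingleton_apply_one (M₁ := E) ℝ v)).mp this

theorem comp_within (h : HasVelocity k p v) {f : N → N'} {s : Set N}
    {f' : TangentSpace 𝓘(ℝ, E) p →L[ℝ] TangentSpace 𝓘(ℝ, E') (f p)}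
    (hf : HasMFDerivWithinAt 𝓘(ℝ, E) 𝓘(ℝ, E') f s p f') (hs : ∀ᶠ t in 𝓝 0, k t ∈ s) :
    HasVelocity (f ∘ k) (f p) (f' v) := by
  obtain ⟨rfl, h⟩ := h
  have := ((hf.comp (s := {t | k t ∈ s}) 0 h.hasMFDerivWithinAt
    (fun t ht => ht)).hasMFDerivAt hs).hasVelocity
  exact (congrArg (fun u => HasVelocity (f ∘ k) (f (k 0)) (f' u))
    (ContinuousLinearMap.toSpanSingleton_apply_one (M₁ := E) ℝ v)).mp this

theorem continuousAt (h : HasVelocity k p v) : ContinuousAt k 0 := h.2.continuousAt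

theorem tendsto (h : HasVelocity k p v) : Filter.Tendsto k (𝓝 0) (𝓝 p) := by
  have := h.continuousAt
  rwa [ContinuousAt, h.1] at this

theorem hasDerivAt (h : HasVelocity k p v) {f : N → ℝ}
    (hf : MDifferentiableAt 𝓘(ℝ, E) 𝓘(ℝ, ℝ) f p) :
    HasDerivAt (fun t => f (k t)) (mfderiv 𝓘(ℝ, E) 𝓘(ℝ, ℝ) f p v) 0 := by
  have : HasFDerivAt (f ∘ k) (ContinuousLinearMap.toSpanSingleton ℝ
      (mfderiv 𝓘(ℝ, E) 𝓘(ℝ, ℝ) f p v : ℝ)) 0 :=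
    hasMFDerivAt_iff_hasFDerivAt.1 (h.comp hf.hasMFDerivAt).2
  exact this

end HasVelocity

theorem MDifferentiableAt.hasVelocity {k : ℝ → N} (h : MDifferentiableAt 𝓘(ℝ, ℝ) 𝓘(ℝ, E) k 0) :
    HasVelocity k (k 0) (mfderiv 𝓘(ℝ, ℝ) 𝓘(ℝ, E) k 0 (1 : ℝ)) :=
  h.hasMFDerivAt.hasVelocity

/-- The affine curve in a vector space. -/
theorem hasVelocity_line (a b : E) :
    HasVelocity (E := E) (fun t : ℝ => a + t • b) a b := by
  have h : HasDerivAt (fun t : ℝ => a + t • b) b 0 := by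
    simpa using ((hasDerivAt_id (0 : ℝ)).smul_const b).const_add a
  refine ⟨by simp, ?_⟩
  exact (hasMFDerivAt_iff_hasFDerivAt.2 h.hasFDerivAt :)

/-- The chain rule along the diagonal of a map of two real variables. -/
theorem hasVelocity_diag {m : ℝ × ℝ → N} (h : MDifferentiableAt 𝓘(ℝ, ℝ × ℝ) 𝓘(ℝ, E) m (0, 0))
    {p : N} {v w u : TangentSpace 𝓘(ℝ, E) p} (hv : HasVelocity (fun t => m (t, 0)) p v)
    (hw : HasVelocity (fun t => m (0, t)) p w) (hu : HasVelocity (fun t => m (t, t)) p u) :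
    u = v + w := by
  have hp : m (0, 0) = p := hv.1
  subst hp
  let L : ℝ × ℝ →L[ℝ] E := mfderiv 𝓘(ℝ, ℝ × ℝ) 𝓘(ℝ, E) m (0, 0)
  have key : ∀ a : ℝ × ℝ, HasVelocity (fun t : ℝ => m ((0, 0) + t • a)) (m (0, 0)) (L a) :=
    fun a => (hasVelocity_line (E := ℝ × ℝ) (0, 0) a).comp h.hasMFDerivAt
  have e1 : v = L (1, 0) := hv.unique (by simpa using key (1, 0))
  have e2 : w = L (0, 1) := hw.unique (by simpa using key (0, 1))
  have e3 : u = L (1, 1) := hu.unique (by simpa using key (1, 1))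
  have e4 : L (1, 1) = L (1, 0) + L (0, 1) := by
    rw [← map_add]
    simp
  rw [e1, e2, e3]
  exact e4

/-- Every tangent vector is the velocity of a curve. -/
theorem exists_hasVelocity [IsManifold 𝓘(ℝ, E) ∞ N] (p : N) (v : E) :
    ∃ c : ℝ → N, ContMDiffAt 𝓘(ℝ, ℝ) 𝓘(ℝ, E) ∞ c 0 ∧ HasVelocity c p v := by
  set φ := extChartAt 𝓘(ℝ, E) p with hφ
  have : IsManifold 𝓘(ℝ, E) 1 N := .of_le (n := ∞) (by norm_cast)
  have hl : HasVelocity (fun t : ℝ => φ p + t • v) (φ p) v := hasVelocity_line (φ p) v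
  have hc : ContMDiffAt 𝓘(ℝ, ℝ) 𝓘(ℝ, E) ∞ (fun t : ℝ => φ.symm (φ p + t • v)) 0 := by
    have h1 : ContMDiffAt 𝓘(ℝ, ℝ) 𝓘(ℝ, E) ∞ (fun t : ℝ => φ p + t • v) 0 := by
      rw [contMDiffAt_iff_contDiffAt]
      fun_prop
    refine ContMDiffAt.comp (g := φ.symm) (0 : ℝ) ?_ h1
    simp only [zero_smul, add_zero]
    exact (contMDiffOn_extChartAt_symm p).contMDiffAt (extChartAt_target_mem_nhds p)
  refine ⟨_, hc, ?_⟩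
  have hw := (hc.mdifferentiableAt (by simp)).hasVelocity.base
    (show φ.symm (φ p + (0 : ℝ) • v) = p by simp [hφ])
  have hφp : mfderiv 𝓘(ℝ, E) 𝓘(ℝ, E) φ p = ContinuousLinearMap.id ℝ _ :=
    mfderiv_extChartAt_self
  -- Read in the chart, whose differential at its own centre is the identity, the curve is the line
  -- again; hence its velocity is `v`.
  have h2 := (hw.comp (mdifferentiableAt_extChartAt
    (I := 𝓘(ℝ, E)) (mem_chart_source E p)).hasMFDerivAt).congr (k' := fun t : ℝ => φ p + t • v) (by
      have ht := hl.tendsto.eventually (extChartAt_target_mem_nhds (I := 𝓘(ℝ, E)) p)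
      filter_upwards [ht] with t ht
      exact (φ.right_inv ht).symm)
  rw [hφp] at h2
  have h3 := h2.unique hl
  let w : E := mfderiv 𝓘(ℝ, ℝ) 𝓘(ℝ, E) (fun t : ℝ => φ.symm (φ p + t • v)) 0 (1 : ℝ)
  have h4 : w = v := h3
  change HasVelocity _ p w at hw
  rwa [h4] at hw

/-- A submersion admits a local smooth retraction of the product of its target and its source onto
its graph. -/
theorem Manifold.IsSubmersionAt.exists_retraction {f : N → N'} {p : N}
    (h : Manifold.IsSubmersionAt 𝓘(ℝ, E) 𝓘(ℝ, E') ∞ f p) :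
    ∃ ρ : N' × N → N,
      ContMDiffAt (𝓘(ℝ, E').prod 𝓘(ℝ, E)) 𝓘(ℝ, E) ∞ ρ (f p, p) ∧
      (∀ᶠ q in 𝓝 (f p, p), f (ρ q) = q.1) ∧ ∀ᶠ q in 𝓝 p, ρ (f q, q) = q := by
  set φ := h.domChart
  set ψ := h.codChart
  set e := h.equiv
  have hw : ∀ z ∈ φ.target, ψ (f (φ.symm z)) = (e z).1 := by
    intro z hz
    have := h.writtenInCharts (show z ∈ (h.domChart.extend 𝓘(ℝ, E)).target by simpa using hz)
    simpa using this
  have hp : p ∈ φ.source := h.mem_domChart_source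
  have hfp : f p ∈ ψ.source := h.mem_codChart_source
  have hmap : ∀ q ∈ φ.source, f q ∈ ψ.source := fun q hq => h.source_subset_preimage_source hq
  -- In submersion charts `f` is the projection to the first factor. The retraction takes the first
  -- coordinate from the point of `N'` and keeps the second coordinate of the point of `N`.
  let c : N' × N → E := fun q => e.symm (ψ q.1, (e (φ q.2)).2)
  have hcf : ∀ q ∈ φ.source, c (f q, q) = φ q := by
    intro q hq
    have := hw (φ q) (φ.map_source hq)
    rw [φ.left_inv hq] at this
    simp [c, this]
  have hψ : ContMDiffAt 𝓘(ℝ, E') 𝓘(ℝ, E') ∞ ψ (f p) :=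
    contMDiffAt_of_mem_maximalAtlas h.codChart_mem_maximalAtlas hfp
  have hφ : ContMDiffAt 𝓘(ℝ, E) 𝓘(ℝ, E) ∞ φ p :=
    contMDiffAt_of_mem_maximalAtlas h.domChart_mem_maximalAtlas hp
  have hc : ContMDiffAt (𝓘(ℝ, E').prod 𝓘(ℝ, E)) 𝓘(ℝ, E) ∞ c (f p, p) := by
    have h1 : ContMDiffAt (𝓘(ℝ, E').prod 𝓘(ℝ, E)) 𝓘(ℝ, E') ∞ (fun q : N' × N => ψ q.1) (f p, p) :=
      ContMDiffAt.comp (f p, p) (f := Prod.fst) hψ contMDiffAt_fst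
    have h2 : ContMDiffAt (𝓘(ℝ, E').prod 𝓘(ℝ, E)) 𝓘(ℝ, E) ∞ (fun q : N' × N => φ q.2) (f p, p) :=
      ContMDiffAt.comp (f p, p) (f := Prod.snd) hφ contMDiffAt_snd
    have h3 := h1.prodMk_space
      (((ContinuousLinearMap.snd ℝ E' h.complement).comp e.toContinuousLinearMap).contMDiff.contMDiffAt.comp _ h2)
    exact e.symm.toContinuousLinearMap.contMDiff.contMDiffAt.comp _ h3
  have hct : ∀ᶠ q in 𝓝 (f p, p), c q ∈ φ.target := by
    refine hc.continuousAt.eventually (φ.open_target.mem_nhds ?_)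
    rw [hcf p hp]
    exact φ.map_source hp
  refine ⟨fun q => φ.symm (c q), ?_, ?_, ?_⟩
  · refine ContMDiffAt.comp (f p, p) ?_ hc
    refine contMDiffAt_symm_of_mem_maximalAtlas h.domChart_mem_maximalAtlas ?_
    rw [hcf p hp]
    exact φ.map_source hp
  · have hs : ∀ᶠ q in 𝓝 (f p, p), q.1 ∈ ψ.source :=
      continuousAt_fst.eventually (ψ.open_source.mem_nhds hfp)
    filter_upwards [hct, hs] with q hq hq'
    refine ψ.injOn (hmap _ (φ.map_target hq)) hq' ?_
    rw [hw _ hq]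
    simp [c]
  · filter_upwards [φ.open_source.mem_nhds hp] with q hq
    rw [hcf q hq, φ.left_inv hq]

end Velocity

/-! ### Inversion, representatives, and curves in the fibres of a groupoid. -/

namespace LieGroupoid

variable {EM : Type*} [NormedAddCommGroup EM] [NormedSpace ℝ EM]
  {EG : Type*} [NormedAddCommGroup EG] [NormedSpace ℝ EG]
  {M : Type*} [TopologicalSpace M] [ChartedSpace EM M]
  {G : Type*} [TopologicalSpace G] [ChartedSpace EG G]

section Algebra

variable (A : LieGroupoid EM EG M G)

theorem eq_inv_of_mul_eq_unit {g h : G} (hgh : A.src g = A.tgt h)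
    (h1 : A.mul g h = A.unit (A.tgt g)) : h = A.inv g := by
  have e1 := A.mul_assoc (A.inv g) g h (A.src_inv g) hgh
  have e2 := A.mul_unit (A.inv g)
  rw [A.src_inv] at e2
  rw [h1, e2, A.inv_mul, hgh, A.unit_mul] at e1
  exact e1

theorem inv_inv (g : G) : A.inv (A.inv g) = g :=
  (A.eq_inv_of_mul_eq_unit (A.src_inv g) (by rw [A.inv_mul, A.tgt_inv])).symm

theorem inv_unit (x : M) : A.inv (A.unit x) = A.unit x := by
  refine (A.eq_inv_of_mul_eq_unit (by rw [A.src_unit, A.tgt_unit]) ?_).symm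
  have := A.unit_mul (A.unit x)
  rwa [A.tgt_unit] at this ⊢

theorem inv_mul_rev {g h : G} (hgh : A.src g = A.tgt h) :
    A.inv (A.mul g h) = A.mul (A.inv h) (A.inv g) := by
  have c1 : A.src (A.inv h) = A.tgt (A.inv g) := by rw [A.src_inv, A.tgt_inv, hgh]
  have c2 : A.src h = A.tgt (A.mul (A.inv h) (A.inv g)) := by rw [A.tgt_mul _ _ c1, A.tgt_inv]
  refine (A.eq_inv_of_mul_eq_unit ?_ ?_).symm
  · rw [A.src_mul _ _ hgh, c2]
  · have e := A.unit_mul (A.inv g)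
    rw [A.tgt_inv, hgh] at e
    rw [A.mul_assoc _ _ _ hgh c2, ← A.mul_assoc h _ _ (A.tgt_inv h).symm c1, A.mul_inv, e, A.mul_inv,
      A.tgt_mul _ _ hgh]

end Algebra

section Representatives

variable (A : LieGroupoid EM EG M G) (x : M)

theorem toFiber_surjective : Function.Surjective (A.toFiber x) := Submodule.mkQ_surjective _

theorem toFiber_dUnit (u : TangentSpace 𝓘(ℝ, EM) x) : A.toFiber x (A.dUnit x u) = 0 :=
  (Submodule.Quotient.mk_eq_zero _).2 ⟨u, rfl⟩

theorem leftRep_toFiber (v : TangentSpace 𝓘(ℝ, EG) (A.unit x)) :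
    A.leftRep x (A.toFiber x v) = v - A.dUnit x (A.dTgt x v) := rfl

theorem rightRep_toFiber (v : TangentSpace 𝓘(ℝ, EG) (A.unit x)) :
    A.rightRep x (A.toFiber x v) = v - A.dUnit x (A.dSrc x v) := rfl

theorem anchor_toFiber (v : TangentSpace 𝓘(ℝ, EG) (A.unit x)) :
    A.anchor x (A.toFiber x v) = A.dSrc x v - A.dTgt x v := rfl

theorem toFiber_leftRep (e : A.Fiber x) : A.toFiber x (A.leftRep x e) = e := by
  obtain ⟨v, rfl⟩ := A.toFiber_surjective x e
  rw [leftRep_toFiber, map_sub, toFiber_dUnit, sub_zero]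

theorem toFiber_rightRep (e : A.Fiber x) : A.toFiber x (A.rightRep x e) = e := by
  obtain ⟨v, rfl⟩ := A.toFiber_surjective x e
  rw [rightRep_toFiber, map_sub, toFiber_dUnit, sub_zero]

theorem dTgt_leftRep (e : A.Fiber x) : A.dTgt x (A.leftRep x e) = 0 := by
  obtain ⟨v, rfl⟩ := A.toFiber_surjective x e
  rw [leftRep_toFiber, map_sub, dTgt_dUnit, sub_self]

theorem dSrc_leftRep (e : A.Fiber x) : A.dSrc x (A.leftRep x e) = A.anchor x e := by
  obtain ⟨v, rfl⟩ := A.toFiber_surjective x e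
  rw [leftRep_toFiber, map_sub, dSrc_dUnit, anchor_toFiber]

/-- Both vectors represent the same class, so they differ by a vector tangent to the units. This is
the source of `α(X) = X^L - X^R` on functions along M. -/
theorem leftRep_sub_rightRep (e : A.Fiber x) :
    A.leftRep x e - A.rightRep x e = A.dUnit x (A.anchor x e) := by
  obtain ⟨v, rfl⟩ := A.toFiber_surjective x e
  rw [leftRep_toFiber, rightRep_toFiber, anchor_toFiber, map_sub]
  abel

end Representatives

section Smoothness

variable (A : LieGroupoid EM EG M G)

/-- Composability in a whole neighbourhood is what upgrades smoothness on the set of composable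
pairs to smoothness at the point. -/
theorem contMDiffAt_mul {EP : Type*} [NormedAddCommGroup EP] [NormedSpace ℝ EP]
    {HP : Type*} [TopologicalSpace HP] {IP : ModelWithCorners ℝ EP HP}
    {P : Type*} [TopologicalSpace P] [ChartedSpace HP P] {a b : P → G} {p : P}
    (ha : ContMDiffAt IP 𝓘(ℝ, EG) ∞ a p) (hb : ContMDiffAt IP 𝓘(ℝ, EG) ∞ b p)
    (h : ∀ᶠ q in 𝓝 p, A.src (a q) = A.tgt (b q)) :
    ContMDiffAt IP 𝓘(ℝ, EG) ∞ (fun q => A.mul (a q) (b q)) p := by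
  have h1 := ContMDiffWithinAt.comp (s := {q | A.src (a q) = A.tgt (b q)})
    (f := fun q => (a q, b q)) p (A.contMDiffOn_mul (a p, b p) h.self_of_nhds)
    (ha.prodMk hb).contMDiffWithinAt (fun q hq => hq)
  exact h1.contMDiffAt h

theorem mdifferentiableAt_src (g : G) : MDifferentiableAt 𝓘(ℝ, EG) 𝓘(ℝ, EM) A.src g :=
  (A.contMDiff_src g).mdifferentiableAt (by simp)

theorem mdifferentiableAt_tgt (g : G) : MDifferentiableAt 𝓘(ℝ, EG) 𝓘(ℝ, EM) A.tgt g :=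
  (A.contMDiff_tgt g).mdifferentiableAt (by simp)

theorem mdifferentiableAt_unit (x : M) : MDifferentiableAt 𝓘(ℝ, EM) 𝓘(ℝ, EG) A.unit x :=
  (A.contMDiff_unit x).mdifferentiableAt (by simp)

theorem mdifferentiableAt_inv (g : G) : MDifferentiableAt 𝓘(ℝ, EG) 𝓘(ℝ, EG) A.inv g :=
  (A.contMDiff_inv g).mdifferentiableAt (by simp)

/-- Every vector tangent to a target fibre at a unit is the velocity of a curve in this fibre. -/
theorem exists_curve [IsManifold 𝓘(ℝ, EG) ∞ G] (x : M) (e : A.Fiber x) :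
    ∃ k : ℝ → G, ContMDiffAt 𝓘(ℝ, ℝ) 𝓘(ℝ, EG) ∞ k 0 ∧ (∀ t, A.tgt (k t) = x) ∧
      HasVelocity k (A.unit x) (A.leftRep x e) := by
  set p := A.unit x with hp
  have htp : A.tgt p = x := A.tgt_unit x
  obtain ⟨ρ, hρ, hρt, hρr⟩ := (A.isSubmersion_tgt.isSubmersionAt p).exists_retraction
  obtain ⟨c, hc, hcv⟩ := exists_hasVelocity (E := EG) p (A.leftRep x e)
  rw [htp] at hρ
  have hcm : MDifferentiableAt 𝓘(ℝ, ℝ) 𝓘(ℝ, EG) c 0 := hc.mdifferentiableAt (by simp)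
  have hc0 : c 0 = p := hcv.1
  have hk : ContMDiffAt 𝓘(ℝ, ℝ) 𝓘(ℝ, EG) ∞ (fun t => ρ (x, c t)) 0 := by
    refine ContMDiffAt.comp (I' := 𝓘(ℝ, EM).prod 𝓘(ℝ, EG)) (0 : ℝ) (g := ρ)
      (f := fun t => (x, c t)) ?_
      (contMDiffAt_const.prodMk hc)
    rwa [hc0]
  have hxp : ρ (x, p) = p := by
    have := hρr.self_of_nhds
    rwa [htp] at this
  have hkw := (hk.mdifferentiableAt (by simp)).hasVelocity.base
    (show ρ (x, c 0) = p by rw [hc0, hxp])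
  -- The diagonal of this map is `c` itself near `0`. Its derivative in the first variable is zero
  -- because `leftRep` is tangent to the target fibre. So moving the second variable alone, which
  -- keeps the target equal to `x`, already gives the velocity of `c`.
  have hm : MDifferentiableAt 𝓘(ℝ, ℝ × ℝ) 𝓘(ℝ, EG)
      (fun q : ℝ × ℝ => ρ (A.tgt (c q.1), c q.2)) (0, 0) := by
    refine MDifferentiableAt.comp ((0 : ℝ), (0 : ℝ)) (g := ρ)
      (f := fun q : ℝ × ℝ => (A.tgt (c q.1), c q.2)) (I' := 𝓘(ℝ, EM).prod 𝓘(ℝ, EG)) ?_ ?_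
    · simp only [hc0, htp]
      exact hρ.mdifferentiableAt (by simp)
    · refine MDifferentiableAt.prodMk ?_ ?_
      · refine MDifferentiableAt.comp ((0 : ℝ), (0 : ℝ)) (g := A.tgt ∘ c) (f := Prod.fst)
          ((A.mdifferentiableAt_tgt _).comp _ hcm) differentiableAt_fst.mdifferentiableAt
      · exact MDifferentiableAt.comp ((0 : ℝ), (0 : ℝ)) (g := c) (f := Prod.snd)
          hcm differentiableAt_snd.mdifferentiableAt
  let w : EG := mfderiv 𝓘(ℝ, ℝ) 𝓘(ℝ, EG) (fun t => ρ (x, c t)) 0 (1 : ℝ)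
  change HasVelocity _ p w at hkw
  have h1 : HasVelocity (fun s => ρ (A.tgt (c s), c 0)) p (0 : EG) := by
    have ht := hcv.comp (A.mdifferentiableAt_tgt p).hasMFDerivAt
    have h0 : mfderiv 𝓘(ℝ, EG) 𝓘(ℝ, EM) A.tgt p (A.leftRep x e) = 0 := A.dTgt_leftRep x e
    rw [h0] at ht
    have hρ1 : MDifferentiableAt 𝓘(ℝ, EM) 𝓘(ℝ, EG) (fun y => ρ (y, p)) (A.tgt p) := by
      refine (ContMDiffAt.comp (n := ∞) (I' := 𝓘(ℝ, EM).prod 𝓘(ℝ, EG)) (A.tgt p) (g := ρ)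
        (f := fun y => (y, p)) ?_
        (contMDiffAt_id.prodMk contMDiffAt_const)).mdifferentiableAt (by simp)
      rwa [htp]
    have := ht.comp hρ1.hasMFDerivAt
    rw [map_zero] at this
    rw [hc0]
    exact this.base (by rw [htp, hxp])
  have h2 : HasVelocity (fun t => ρ (A.tgt (c 0), c t)) p w := by
    rw [hc0, htp]
    exact hkw
  have h3 : HasVelocity (fun t => ρ (A.tgt (c t), c t)) p (A.leftRep x e) :=
    hcv.congr (hcv.tendsto.eventually hρr)
  have h4 := hasVelocity_diag hm h1 h2 h3
  have h5 : HasVelocity (fun t => ρ (x, c t)) p (A.leftRep x e) := by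
    rw [h4]
    exact (congrArg (HasVelocity _ p) (zero_add w)).mpr hkw
  have hev : ∀ᶠ t in 𝓝 (0 : ℝ), A.tgt (ρ (x, c t)) = x := by
    have h6 : Filter.Tendsto (fun t => (x, c t)) (𝓝 0) (𝓝 (x, p)) :=
      tendsto_const_nhds.prodMk_nhds hcv.tendsto
    rw [htp] at hρt
    exact h6.eventually hρt
  classical
  -- The retracted curve lies in the fibre only for small `t`; the unit is inserted elsewhere so
  -- that the constraint on the target holds for all `t`.
  let k : ℝ → G := fun t => if A.tgt (ρ (x, c t)) = x then ρ (x, c t) else p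
  have hkk : ∀ᶠ t in 𝓝 (0 : ℝ), k t = ρ (x, c t) := by
    filter_upwards [hev] with t ht
    exact if_pos ht
  refine ⟨k, hk.congr_of_eventuallyEq hkk, fun t => ?_, h5.congr hkk⟩
  by_cases ht : A.tgt (ρ (x, c t)) = x
  · simp only [k, if_pos ht, ht]
  · simp only [k, if_neg ht, htp]

/-- Left-invariant vector fields are given by left translation of curves in the target fibres. -/
theorem hasVelocity_mul_left [IsManifold 𝓘(ℝ, EG) ∞ G] (X : A.Sec) {g : G} {x : M}
    (hx : A.src g = x) {k : ℝ → G} (hk : HasVelocity k (A.unit x) (A.leftRep x (X.1 x)))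
    (ht : ∀ᶠ t in 𝓝 0, A.tgt (k t) = x) :
    HasVelocity (fun t => A.mul g (k t)) g (A.left X g) := by
  subst hx
  have h1 : MDifferentiableWithinAt 𝓘(ℝ, EG) 𝓘(ℝ, EG) (fun h => A.mul g h)
      {h | A.tgt h = A.src g} (A.unit (A.src g)) := by
    have := ContMDiffWithinAt.comp (s := {h | A.tgt h = A.src g}) (f := fun h => (g, h))
      (A.unit (A.src g)) (A.contMDiffOn_mul (g, A.unit (A.src g)) (A.tgt_unit _).symm)
      (contMDiffAt_const.prodMk contMDiffAt_id).contMDiffWithinAt (fun q hq => Eq.symm hq)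
    exact this.mdifferentiableWithinAt (by simp)
  exact (hk.comp_within h1.hasMFDerivWithinAt ht).base (A.mul_unit g)

/-- Right-invariant vector fields are given by right translation of curves in the source fibres. -/
theorem hasVelocity_mul_right [IsManifold 𝓘(ℝ, EG) ∞ G] (X : A.Sec) {g : G} {x : M}
    (hx : A.tgt g = x) {k : ℝ → G} (hk : HasVelocity k (A.unit x) (A.rightRep x (X.1 x)))
    (ht : ∀ᶠ t in 𝓝 0, A.src (k t) = x) :
    HasVelocity (fun t => A.mul (k t) g) g (A.right X g) := by
  subst hx
  have h1 : MDifferentiableWithinAt 𝓘(ℝ, EG) 𝓘(ℝ, EG) (fun h => A.mul h g)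
      {h | A.src h = A.tgt g} (A.unit (A.tgt g)) := by
    have := ContMDiffWithinAt.comp (s := {h | A.src h = A.tgt g}) (f := fun h => (h, g))
      (A.unit (A.tgt g)) (A.contMDiffOn_mul (A.unit (A.tgt g), g) (A.src_unit _))
      (contMDiffAt_id.prodMk contMDiffAt_const).contMDiffWithinAt (fun q hq => hq)
    exact this.mdifferentiableWithinAt (by simp)
  exact (hk.comp_within h1.hasMFDerivWithinAt ht).base (A.unit_mul g)

/-- The inverse of a curve in a target fibre. -/
theorem hasVelocity_inv (x : M) (e : A.Fiber x) {k : ℝ → G}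
    (hks : ContMDiffAt 𝓘(ℝ, ℝ) 𝓘(ℝ, EG) ∞ k 0) (hkt : ∀ t, A.tgt (k t) = x)
    (hk : HasVelocity k (A.unit x) (A.leftRep x e)) :
    HasVelocity (fun t => A.inv (k t)) (A.unit x) (-A.rightRep x e) := by
  have hk0 : k 0 = A.unit x := hk.1
  have hiks : ContMDiffAt 𝓘(ℝ, ℝ) 𝓘(ℝ, EG) ∞ (fun t => A.inv (k t)) 0 :=
    ContMDiffAt.comp (0 : ℝ) (A.contMDiff_inv _) hks
  have hi := (hiks.mdifferentiableAt (by simp)).hasVelocity.base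
    (show A.inv (k 0) = A.unit x by rw [hk0, A.inv_unit])
  -- On the diagonal the product is `unit (src (k t))`, with velocity `dUnit (anchor e)`, that is,
  -- left minus right representative. The second factor contributes the left representative, which
  -- leaves minus the right one for the inverse curve.
  have hm : ContMDiffAt 𝓘(ℝ, ℝ × ℝ) 𝓘(ℝ, EG)
      ∞ (fun q : ℝ × ℝ => A.mul (A.inv (k q.1)) (k q.2)) (0, 0) := by
    refine A.contMDiffAt_mul ?_ ?_ (.of_forall fun q => by rw [A.src_inv, hkt, hkt])
    · exact ContMDiffAt.comp ((0 : ℝ), (0 : ℝ)) (g := fun t => A.inv (k t)) (f := Prod.fst) hiks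
        contDiffAt_fst.contMDiffAt
    · exact ContMDiffAt.comp ((0 : ℝ), (0 : ℝ)) (g := k) (f := Prod.snd) hks
        contDiffAt_snd.contMDiffAt
  have h1 : HasVelocity (fun t => A.mul (A.inv (k t)) (k 0)) (A.unit x) _ := hi.congr
    (.of_forall fun t => by
      have := A.mul_unit (A.inv (k t))
      rwa [A.src_inv, hkt, ← hk0] at this)
  have h2 : HasVelocity (fun t => A.mul (A.inv (k 0)) (k t)) (A.unit x) _ := hk.congr
    (.of_forall fun t => by
      have := A.unit_mul (k t)
      rwa [hkt, ← A.inv_unit, ← hk0] at this)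
  have h3 : HasVelocity (fun t => A.mul (A.inv (k t)) (k t)) (A.unit x)
      (A.dUnit x (A.anchor x e)) := by
    have h4 := (hk.comp (A.mdifferentiableAt_src _).hasMFDerivAt).base (A.src_unit x)
    have h5 := (h4.comp (A.mdifferentiableAt_unit _).hasMFDerivAt)
    have h6 : mfderiv 𝓘(ℝ, EG) 𝓘(ℝ, EM) A.src (A.unit x) (A.leftRep x e) = A.anchor x e :=
      A.dSrc_leftRep x e
    rw [h6] at h5
    exact h5.congr (.of_forall fun t => A.inv_mul (k t))
  have h7 := hasVelocity_diag (hm.mdifferentiableAt (by simp)) h1 h2 h3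
  rw [← A.leftRep_sub_rightRep] at h7
  let w : EG := mfderiv 𝓘(ℝ, ℝ) 𝓘(ℝ, EG) (fun t => A.inv (k t)) 0 (1 : ℝ)
  let l : EG := A.leftRep x e
  let r : EG := A.rightRep x e
  have h8 : -r = w := by
    have h9 : l - r = w + l := h7
    rw [← sub_eq_iff_eq_add.2 h9, sub_sub_cancel_left]
  change HasVelocity _ _ (-r)
  rw [h8]
  exact hi

theorem left_neg [IsManifold 𝓘(ℝ, EG) ∞ G] (X : A.Sec) (g : G) : A.left (-X) g = -A.left X g := by
  simp only [left, Submodule.coe_neg, Pi.neg_apply, map_neg]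
  rfl

/-- The inversion maps left-invariant to right-invariant vector fields. -/
theorem right_inv [IsManifold 𝓘(ℝ, EG) ∞ G] (X : A.Sec) (g : G) :
    A.right X (A.inv g) = mfderiv 𝓘(ℝ, EG) 𝓘(ℝ, EG) A.inv g (A.left (-X) g) := by
  -- Inversion turns a left representative into minus the right one, so the curve is chosen for
  -- `-X`.
  obtain ⟨k, hks, hkt, hk⟩ := A.exists_curve (A.src g) ((-X).1 (A.src g))
  have h1 := A.hasVelocity_mul_left (-X) rfl hk (.of_forall hkt)
  have h2 := h1.comp (A.mdifferentiableAt_inv g).hasMFDerivAt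
  have h3 := A.hasVelocity_inv _ _ hks hkt hk
  have h4 : -A.rightRep (A.src g) ((-X).1 (A.src g)) = A.rightRep (A.src g) (X.1 (A.src g)) := by
    rw [← map_neg]
    simp
  rw [h4] at h3
  have h5 := A.hasVelocity_mul_right X (A.tgt_inv g) h3
    (.of_forall fun t => by rw [A.src_inv, hkt])
  exact h5.unique (h2.congr (.of_forall fun t => (A.inv_mul_rev (hkt t).symm).symm))


end Smoothness

end LieGroupoid

/-! ### Smoothness of invariant vector fields. -/

section TangentBundle

variable {E : Type*} [NormedAddCommGroup E] [NormedSpace ℝ E]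
  {E₁ : Type*} [NormedAddCommGroup E₁] [NormedSpace ℝ E₁]
  {E₂ : Type*} [NormedAddCommGroup E₂] [NormedSpace ℝ E₂]
  {P : Type*} [TopologicalSpace P] [ChartedSpace E P]
  {N₁ : Type*} [TopologicalSpace N₁] [ChartedSpace E₁ N₁]
  {N₂ : Type*} [TopologicalSpace N₂] [ChartedSpace E₂ N₂]
  [IsManifold 𝓘(ℝ, E) ∞ P] [IsManifold 𝓘(ℝ, E₁) ∞ N₁] [IsManifold 𝓘(ℝ, E₂) ∞ N₂]

/-- The partial derivative of a smooth family of maps in the direction of a smooth family of tangent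
vectors is smooth. -/
theorem ContMDiffAt.mfderiv_apply_bundle (f : P → N₁ → N₂) {c : P → N₁}
    {v : ∀ q, TangentSpace 𝓘(ℝ, E₁) (c q)} {p : P}
    (hf : ContMDiffAt (𝓘(ℝ, E).prod 𝓘(ℝ, E₁)) 𝓘(ℝ, E₂) ∞ (Function.uncurry f) (p, c p))
    (hv : ContMDiffAt 𝓘(ℝ, E) (𝓘(ℝ, E₁).prod 𝓘(ℝ, E₁)) ∞
      (fun q => (⟨c q, v q⟩ : TangentBundle 𝓘(ℝ, E₁) N₁)) p) :
    ContMDiffAt 𝓘(ℝ, E) (𝓘(ℝ, E₂).prod 𝓘(ℝ, E₂)) ∞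
      (fun q => (⟨f q (c q), mfderiv 𝓘(ℝ, E₁) 𝓘(ℝ, E₂) (f q) (c q) (v q)⟩ :
        TangentBundle 𝓘(ℝ, E₂) N₂)) p := by
  have : IsManifold 𝓘(ℝ, E) 1 P := .of_le (n := ∞) (by norm_cast)
  have : IsManifold 𝓘(ℝ, E₁) 1 N₁ := .of_le (n := ∞) (by norm_cast)
  have : IsManifold 𝓘(ℝ, E₂) 1 N₂ := .of_le (n := ∞) (by norm_cast)
  have hc : ContMDiffAt 𝓘(ℝ, E) 𝓘(ℝ, E₁) ∞ c p := (Bundle.contMDiffAt_totalSpace.1 hv).1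
  have h1 := ContMDiffAt.mfderiv (m := ∞) f c hf hc (by norm_cast)
  exact ContMDiffAt.clm_apply_of_inCoordinates h1 hv (hf.comp p (contMDiffAt_id.prodMk hc))

omit [IsManifold 𝓘(ℝ, E) ∞ P] in
theorem contMDiffAt_snd_tangentBundle {b : P → E₂} {v : ∀ q, TangentSpace 𝓘(ℝ, E₂) (b q)} {p : P}
    (h : ContMDiffAt 𝓘(ℝ, E) (𝓘(ℝ, E₂).prod 𝓘(ℝ, E₂)) ∞
      (fun q => (⟨b q, v q⟩ : TangentBundle 𝓘(ℝ, E₂) E₂)) p) :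
    ContMDiffAt 𝓘(ℝ, E) 𝓘(ℝ, E₂) ∞ (fun q => (v q : E₂)) p := by
  have := (Bundle.contMDiffAt_totalSpace.1 h).2
  simpa using this

end TangentBundle

namespace LieGroupoid

variable {EM : Type*} [NormedAddCommGroup EM] [NormedSpace ℝ EM]
  {EG : Type*} [NormedAddCommGroup EG] [NormedSpace ℝ EG]
  {M : Type*} [TopologicalSpace M] [ChartedSpace EM M]
  {G : Type*} [TopologicalSpace G] [ChartedSpace EG G] [IsManifold 𝓘(ℝ, EG) ∞ G]

theorem contMDiff_dirDeriv {V : ∀ g : G, TangentSpace 𝓘(ℝ, EG) g} {f : G → ℝ}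
    (hV : ContMDiff 𝓘(ℝ, EG) (𝓘(ℝ, EG).prod 𝓘(ℝ, EG)) ∞
      (fun g => (⟨g, V g⟩ : TangentBundle 𝓘(ℝ, EG) G)))
    (hf : ContMDiff 𝓘(ℝ, EG) 𝓘(ℝ, ℝ) ∞ f) : ContMDiff 𝓘(ℝ, EG) 𝓘(ℝ, ℝ) ∞ (dirDeriv V f) := by
  intro g
  exact contMDiffAt_snd_tangentBundle (ContMDiffAt.mfderiv_apply_bundle (fun _ : G => f)
    (((hf _).comp (g, g) contMDiffAt_snd)) (hV g))

variable (A : LieGroupoid EM EG M G)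

/-- The correction subtracted from a smooth representative is the tangent map of `unit ∘ tgt`
applied to it, hence smooth. -/
theorem isSmoothAlong_leftRep (X : A.Sec) : A.IsSmoothAlong (fun x => A.leftRep x (X.1 x)) := by
  obtain ⟨V, hV, hVX⟩ := X.2
  have : IsManifold 𝓘(ℝ, EG) 1 G := .of_le (n := ∞) (by norm_cast)
  have h1 : A.IsSmoothAlong (fun x => A.dUnit x (A.dTgt x (V x))) := by
    have h2 := (A.contMDiff_unit.comp A.contMDiff_tgt).contMDiff_tangentMap (m := ∞) (by norm_cast)
    have h3 := h2.comp hV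
    refine h3.congr fun x => ?_
    -- Only transports along `tgt (unit x) = x`, which is not a definitional equality.
    have h4 : ∀ y z, y = z → ∀ v : EG, (⟨A.unit y, mfderiv 𝓘(ℝ, EM) 𝓘(ℝ, EG) A.unit y
        (mfderiv 𝓘(ℝ, EG) 𝓘(ℝ, EM) A.tgt (A.unit x) v)⟩ : TangentBundle 𝓘(ℝ, EG) G) =
        ⟨A.unit z, mfderiv 𝓘(ℝ, EM) 𝓘(ℝ, EG) A.unit z
        (mfderiv 𝓘(ℝ, EG) 𝓘(ℝ, EM) A.tgt (A.unit x) v)⟩ := by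
      rintro y _ rfl v
      rfl
    refine (h4 _ _ (A.tgt_unit x).symm (V x)).trans ?_
    simp only [tangentMap, Function.comp_apply]
    rw [mfderiv_comp _ (A.mdifferentiableAt_unit _) (A.mdifferentiableAt_tgt _)]
    rfl
  have h2 := hV.add (h1.smul (f := fun _ => -1) contMDiff_const)
  have h3 : (fun x => A.leftRep x (X.1 x)) = V + fun x => (-1 : ℝ) • A.dUnit x (A.dTgt x (V x)) := by
    funext x
    rw [← hVX, leftRep_toFiber, Pi.add_apply, neg_one_smul, ← sub_eq_add_neg]
  rw [h3]
  exact h2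

/-- Left-invariant vector fields are smooth. -/
theorem contMDiff_left [IsManifold 𝓘(ℝ, EM) ∞ M] (X : A.Sec) :
    ContMDiff 𝓘(ℝ, EG) (𝓘(ℝ, EG).prod 𝓘(ℝ, EG)) ∞
      (fun g => (⟨g, A.left X g⟩ : TangentBundle 𝓘(ℝ, EG) G)) := by
  intro g₀
  set p := A.unit (A.src g₀) with hp
  have htp : A.tgt p = A.src g₀ := A.tgt_unit _
  obtain ⟨ρ, hρ, hρt, hρr⟩ := (A.isSubmersion_tgt.isSubmersionAt p).exists_retraction
  rw [htp] at hρ hρt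
  -- Near the unit, `f g` agrees with left translation by `g` on the target fibre of `src g`. Thanks
  -- to the retraction it is smooth on an open set, so the fibrewise differential becomes a partial
  -- derivative of a smooth map.
  let f : G → G → G := fun g h => A.mul g (ρ (A.src g, h))
  let c : G → G := fun g => A.unit (A.src g)
  have hc : ContMDiff 𝓘(ℝ, EG) 𝓘(ℝ, EG) ∞ c := A.contMDiff_unit.comp A.contMDiff_src
  have hs : ContMDiffAt (𝓘(ℝ, EG).prod 𝓘(ℝ, EG)) (𝓘(ℝ, EM).prod 𝓘(ℝ, EG)) ∞
      (fun q : G × G => (A.src q.1, q.2)) (g₀, p) :=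
    (A.contMDiff_src.contMDiffAt.comp (g₀, p) contMDiffAt_fst).prodMk contMDiffAt_snd
  have hf : ContMDiffAt (𝓘(ℝ, EG).prod 𝓘(ℝ, EG)) 𝓘(ℝ, EG) ∞ (Function.uncurry f) (g₀, p) := by
    refine A.contMDiffAt_mul contMDiffAt_fst (hρ.comp (g₀, p) hs) ?_
    filter_upwards [hs.continuousAt.eventually hρt] with q hq
    exact hq.symm
  have hv : ContMDiffAt 𝓘(ℝ, EG) (𝓘(ℝ, EG).prod 𝓘(ℝ, EG)) ∞
      (fun g => (⟨c g, A.leftRep (A.src g) (X.1 (A.src g))⟩ : TangentBundle 𝓘(ℝ, EG) G)) g₀ :=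
    ((A.isSmoothAlong_leftRep X).comp A.contMDiff_src) g₀
  refine (ContMDiffAt.mfderiv_apply_bundle f hf hv).congr_of_eventuallyEq ?_
  have hf1 : ∀ᶠ g in 𝓝 g₀, MDifferentiableAt 𝓘(ℝ, EG) 𝓘(ℝ, EG) (f g) (c g) := by
    have : IsManifold 𝓘(ℝ, EG) 1 G := .of_le (n := ∞) (by norm_cast)
    have h1 := (contMDiffAt_iff_contMDiffAt_nhds (n := 1) (by norm_cast)).1
      (hf.of_le (m := 1) (by norm_cast))
    have h2 : Filter.Tendsto (fun g => (g, c g)) (𝓝 g₀) (𝓝 (g₀, p)) :=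
      Filter.tendsto_id.prodMk_nhds (hc.continuous.tendsto g₀)
    filter_upwards [h2.eventually h1] with g hg
    exact (ContMDiffAt.comp (c g) (g := Function.uncurry f) (f := fun h => (g, h)) hg
      (contMDiffAt_const.prodMk contMDiffAt_id)).mdifferentiableAt (by simp)
  have hr : ∀ᶠ g in 𝓝 g₀, ∀ᶠ h in 𝓝 (c g), ρ (A.tgt h, h) = h :=
    (hc.continuous.tendsto g₀).eventually hρr.eventually_nhds
  filter_upwards [hf1, hr] with g hg1 hg2
  obtain ⟨k, -, hkt, hk⟩ := A.exists_curve (A.src g) (X.1 (A.src g))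
  have h1 := A.hasVelocity_mul_left X rfl hk (.of_forall hkt)
  have h2 := hk.comp hg1.hasMFDerivAt
  have h3 : f g (c g) = g := by
    have := hg2.self_of_nhds
    simp only [c, A.tgt_unit] at this
    simp only [f, c, this, A.mul_unit]
  have h4 := (h2.base h3).congr (k' := fun t => A.mul g (k t)) (by
    filter_upwards [hk.tendsto.eventually hg2] with t ht
    rw [hkt] at ht
    simp only [f, Function.comp_apply, ht])
  have h5 := h1.unique h4
  rw [h5]
  have h6 : ∀ q : G, q = g → ∀ v : EG, (⟨g, v⟩ : TangentBundle 𝓘(ℝ, EG) G) = ⟨q, v⟩ := by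
    rintro _ rfl v
    rfl
  exact h6 _ h3 _

/-- Right-invariant vector fields are smooth. -/
theorem contMDiff_right [IsManifold 𝓘(ℝ, EM) ∞ M] (X : A.Sec) :
    ContMDiff 𝓘(ℝ, EG) (𝓘(ℝ, EG).prod 𝓘(ℝ, EG)) ∞
      (fun g => (⟨g, A.right X g⟩ : TangentBundle 𝓘(ℝ, EG) G)) := by
  have : IsManifold 𝓘(ℝ, EG) 1 G := .of_le (n := ∞) (by norm_cast)
  -- `X^R` is the image of `(-X)^L` under inversion, which reduces the claim to left-invariant
  -- fields.
  have h1 := ((A.contMDiff_inv.contMDiff_tangentMap (m := ∞) (by norm_cast)).comp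
    (A.contMDiff_left (-X))).comp A.contMDiff_inv
  refine h1.congr fun g => ?_
  obtain ⟨h, rfl⟩ : ∃ h, A.inv h = g := ⟨A.inv g, A.inv_inv g⟩
  rw [A.right_inv X h]
  simp only [tangentMap, Function.comp_apply, A.inv_inv]

end LieGroupoid

/-! ### Invariant vector fields as derivations. -/

/-- Each inner derivative is, near the origin, a value of `fderiv ℝ q` on a basis vector, so both
sides are entries of the symmetric second derivative. -/
theorem ContDiffAt.deriv_deriv_comm {q : ℝ × ℝ → ℝ} (hq : ContDiffAt ℝ 2 q (0, 0)) :
    deriv (fun t => deriv (fun s => q (s, t)) 0) 0 =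
      deriv (fun s => deriv (fun t => q (s, t)) 0) 0 := by
  have hd : ∀ᶠ z in 𝓝 ((0 : ℝ), (0 : ℝ)), DifferentiableAt ℝ q z := by
    filter_upwards [hq.eventually (by simp)] with z hz
    exact hz.differentiableAt (by simp)
  have hd2 : DifferentiableAt ℝ (fderiv ℝ q) (0, 0) :=
    (hq.fderiv_right (m := 1) (by norm_num)).differentiableAt (by simp)
  have hl : ∀ a b : ℝ, HasDerivAt (fun s : ℝ => (s, b)) ((1 : ℝ), (0 : ℝ)) a := fun a b =>
    (hasDerivAt_id a).prodMk (hasDerivAt_const a b)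
  have hr : ∀ a b : ℝ, HasDerivAt (fun t : ℝ => (a, t)) ((0 : ℝ), (1 : ℝ)) b := fun a b =>
    (hasDerivAt_const b a).prodMk (hasDerivAt_id b)
  have h1 : (fun t => deriv (fun s => q (s, t)) 0) =ᶠ[𝓝 0] fun t => fderiv ℝ q (0, t) (1, 0) := by
    have : ContinuousAt (fun t : ℝ => ((0 : ℝ), t)) 0 := by fun_prop
    filter_upwards [this.eventually hd] with t ht
    exact (ht.hasFDerivAt.comp_hasDerivAt (0 : ℝ) (hl 0 t)).deriv
  have h2 : (fun s => deriv (fun t => q (s, t)) 0) =ᶠ[𝓝 0] fun s => fderiv ℝ q (s, 0) (0, 1) := by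
    have : ContinuousAt (fun t : ℝ => (t, (0 : ℝ))) 0 := by fun_prop
    filter_upwards [this.eventually hd] with s hs
    exact (hs.hasFDerivAt.comp_hasDerivAt (0 : ℝ) (hr s 0)).deriv
  rw [h1.deriv_eq, h2.deriv_eq]
  have h3 : HasDerivAt (fun t => fderiv ℝ q (0, t)) (fderiv ℝ (fderiv ℝ q) (0, 0) (0, 1)) 0 :=
    hd2.hasFDerivAt.comp_hasDerivAt (0 : ℝ) (hr 0 0)
  have h4 : HasDerivAt (fun s => fderiv ℝ q (s, 0)) (fderiv ℝ (fderiv ℝ q) (0, 0) (1, 0)) 0 :=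
    HasFDerivAt.comp_hasDerivAt (f := fun s : ℝ => (s, (0 : ℝ))) (0 : ℝ) hd2.hasFDerivAt (hl 0 0)
  have h5 := (hq.isSymmSndFDerivAt (by simp)) (1, 0) (0, 1)
  have e3 := (h3.clm_apply (hasDerivAt_const (0 : ℝ) ((1 : ℝ), (0 : ℝ)))).deriv
  have e4 := (h4.clm_apply (hasDerivAt_const (0 : ℝ) ((0 : ℝ), (1 : ℝ)))).deriv
  rw [e3, e4, h5, map_zero]

namespace LieGroupoid

variable {EM : Type*} [NormedAddCommGroup EM] [NormedSpace ℝ EM]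
  {EG : Type*} [NormedAddCommGroup EG] [NormedSpace ℝ EG]
  {M : Type*} [TopologicalSpace M] [ChartedSpace EM M]
  {G : Type*} [TopologicalSpace G] [ChartedSpace EG G]

theorem hasDerivAt_dirDeriv {V : ∀ g : G, TangentSpace 𝓘(ℝ, EG) g} {f : G → ℝ} {g : G} {c : ℝ → G}
    (hc : HasVelocity c g (V g)) (hf : MDifferentiableAt 𝓘(ℝ, EG) 𝓘(ℝ, ℝ) f g) :
    HasDerivAt (fun t => f (c t)) (dirDeriv V f g) 0 :=
  hc.hasDerivAt hf

section Derivation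

variable [IsManifold 𝓘(ℝ, EG) ∞ G] {V W : ∀ g : G, TangentSpace 𝓘(ℝ, EG) g} {f h : G → ℝ} {g : G}

theorem dirDeriv_add (hf : MDifferentiableAt 𝓘(ℝ, EG) 𝓘(ℝ, ℝ) f g)
    (hh : MDifferentiableAt 𝓘(ℝ, EG) 𝓘(ℝ, ℝ) h g) :
    dirDeriv V (fun q => f q + h q) g = dirDeriv V f g + dirDeriv V h g := by
  obtain ⟨c, -, hc⟩ := exists_hasVelocity (E := EG) g (V g)
  exact (hasDerivAt_dirDeriv hc (hf.add hh)).unique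
    ((hasDerivAt_dirDeriv hc hf).add (hasDerivAt_dirDeriv hc hh))

theorem dirDeriv_mul (hf : MDifferentiableAt 𝓘(ℝ, EG) 𝓘(ℝ, ℝ) f g)
    (hh : MDifferentiableAt 𝓘(ℝ, EG) 𝓘(ℝ, ℝ) h g) :
    dirDeriv V (fun q => f q * h q) g = dirDeriv V f g * h g + f g * dirDeriv V h g := by
  obtain ⟨c, -, hc⟩ := exists_hasVelocity (E := EG) g (V g)
  have h1 := (hasDerivAt_dirDeriv hc hf).mul (hasDerivAt_dirDeriv hc hh)
  rw [hc.1] at h1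
  exact (hasDerivAt_dirDeriv hc (hf.mul hh)).unique h1

theorem dirDeriv_const (r : ℝ) : dirDeriv V (fun _ => r) g = 0 := by
  obtain ⟨c, -, hc⟩ := exists_hasVelocity (E := EG) g (V g)
  exact (hasDerivAt_dirDeriv hc mdifferentiableAt_const).unique (hasDerivAt_const _ _)

theorem dirDeriv_neg (hf : MDifferentiableAt 𝓘(ℝ, EG) 𝓘(ℝ, ℝ) f g) :
    dirDeriv V (fun q => -f q) g = -dirDeriv V f g := by
  have := dirDeriv_mul (V := V) (f := fun _ => -1) mdifferentiableAt_const hf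
  rw [dirDeriv_const] at this
  simpa using this

omit [IsManifold 𝓘(ℝ, EG) ∞ G] in
theorem dirDeriv_add_left : dirDeriv (fun q => V q + W q) f g = dirDeriv V f g + dirDeriv W f g :=
  map_add _ _ _

omit [IsManifold 𝓘(ℝ, EG) ∞ G] in
theorem dirDeriv_smul_left (r : G → ℝ) :
    dirDeriv (fun q => r q • V q) f g = r g * dirDeriv V f g :=
  map_smul _ _ _

end Derivation

variable [IsManifold 𝓘(ℝ, EG) ∞ G] (A : LieGroupoid EM EG M G)

theorem left_unit (X : A.Sec) (x : M) : A.left X (A.unit x) = A.leftRep x (X.1 x) := by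
  obtain ⟨k, -, hkt, hk⟩ := A.exists_curve x (X.1 x)
  refine (A.hasVelocity_mul_left X (A.src_unit x) hk (.of_forall hkt)).unique
    (hk.congr (.of_forall fun t => ?_))
  have := A.unit_mul (k t)
  rwa [hkt] at this

/-- Every vector tangent to a source fibre at a unit is the velocity of a curve in this fibre. -/
theorem exists_curve_right (x : M) (e : A.Fiber x) :
    ∃ k : ℝ → G, ContMDiffAt 𝓘(ℝ, ℝ) 𝓘(ℝ, EG) ∞ k 0 ∧ (∀ t, A.src (k t) = x) ∧
      HasVelocity k (A.unit x) (A.rightRep x e) := by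
  obtain ⟨k, hks, hkt, hk⟩ := A.exists_curve x (-e)
  refine ⟨fun t => A.inv (k t), ContMDiffAt.comp (0 : ℝ) (A.contMDiff_inv _) hks,
    fun t => by rw [A.src_inv, hkt], ?_⟩
  have := A.hasVelocity_inv x (-e) hks hkt hk
  rwa [map_neg, neg_neg] at this

theorem right_unit (X : A.Sec) (x : M) : A.right X (A.unit x) = A.rightRep x (X.1 x) := by
  obtain ⟨k, -, hkt, hk⟩ := A.exists_curve_right x (X.1 x)
  refine (A.hasVelocity_mul_right X (A.tgt_unit x) hk (.of_forall hkt)).unique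
    (hk.congr (.of_forall fun t => ?_))
  have := A.mul_unit (k t)
  rwa [hkt] at this

theorem left_add (X Y : A.Sec) : A.left (X + Y) = fun g => A.left X g + A.left Y g := by
  funext g
  simp only [left, Submodule.coe_add, Pi.add_apply, map_add]
  rfl

theorem left_fmul (f : C^∞⟮𝓘(ℝ, EM), M; 𝓘(ℝ, ℝ), ℝ⟯) (X : A.Sec) :
    A.left (A.fmul f X) = fun g => f (A.src g) • A.left X g := by
  funext g
  simp only [left, fmul, map_smul]
  rfl

theorem right_add (X Y : A.Sec) : A.right (X + Y) = fun g => A.right X g + A.right Y g := by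
  funext g
  simp only [right, Submodule.coe_add, Pi.add_apply, map_add]
  rfl

theorem right_fmul (f : C^∞⟮𝓘(ℝ, EM), M; 𝓘(ℝ, ℝ), ℝ⟯) (X : A.Sec) :
    A.right (A.fmul f X) = fun g => f (A.tgt g) • A.right X g := by
  funext g
  simp only [right, fmul, map_smul]
  rfl

/-- Left-invariant vector fields annihilate pullbacks under the target map. -/
theorem dirDeriv_left_comp_tgt (X : A.Sec) {f : M → ℝ} (hf : ContMDiff 𝓘(ℝ, EM) 𝓘(ℝ, ℝ) ∞ f)
    (g : G) : dirDeriv (A.left X) (fun h => f (A.tgt h)) g = 0 := by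
  obtain ⟨k, -, hkt, hk⟩ := A.exists_curve (A.src g) (X.1 (A.src g))
  have h1 := hasDerivAt_dirDeriv (A.hasVelocity_mul_left X rfl hk (.of_forall hkt))
    (f := fun h => f (A.tgt h)) (((hf.comp A.contMDiff_tgt) g).mdifferentiableAt (by simp))
  refine h1.unique ?_
  have h2 : (fun t => f (A.tgt (A.mul g (k t)))) = fun _ => f (A.tgt g) := by
    funext t
    rw [A.tgt_mul _ _ (hkt t).symm]
  rw [h2]
  exact hasDerivAt_const _ _

/-- The derivative along the anchor is the difference of left- and right-invariant derivatives. -/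
theorem anchorDeriv_comp_unit (X : A.Sec) {f : G → ℝ} (hf : ContMDiff 𝓘(ℝ, EG) 𝓘(ℝ, ℝ) ∞ f) (x : M) :
    A.anchorDeriv X (fun y => f (A.unit y)) x =
      dirDeriv (A.left X) f (A.unit x) - dirDeriv (A.right X) f (A.unit x) := by
  have h := mfderiv_comp x ((hf (A.unit x)).mdifferentiableAt (by simp))
    (A.mdifferentiableAt_unit x)
  have h1 : A.anchorDeriv X (fun y => f (A.unit y)) x = mfderiv 𝓘(ℝ, EG) 𝓘(ℝ, ℝ) f (A.unit x)
      (A.dUnit x (A.anchor x (X.1 x))) := congrArg (fun L => L (A.anchor x (X.1 x))) h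
  rw [h1, ← leftRep_sub_rightRep, map_sub, ← left_unit, ← right_unit]
  rfl

/-- `dSrc` sends the left representative to the anchor. This produces the derivative term in the
Leibniz rule. -/
theorem dirDeriv_left_comp_src (X : A.Sec) {f : M → ℝ} (hf : ContMDiff 𝓘(ℝ, EM) 𝓘(ℝ, ℝ) ∞ f)
    (x : M) : dirDeriv (A.left X) (fun h => f (A.src h)) (A.unit x) = A.anchorDeriv X f x := by
  obtain ⟨k, -, hkt, hk⟩ := A.exists_curve x (X.1 x)
  rw [← left_unit] at hk
  have h1 := hasDerivAt_dirDeriv hk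
    (f := fun h => f (A.src h)) (((hf.comp A.contMDiff_src) _).mdifferentiableAt (by simp))
  rw [left_unit] at hk
  have h2 := (hk.comp (A.mdifferentiableAt_src _).hasMFDerivAt).base (A.src_unit x)
  exact h1.unique ((h2.hasDerivAt ((hf x).mdifferentiableAt (by simp))).congr_deriv
    (congrArg (mfderiv 𝓘(ℝ, EM) 𝓘(ℝ, ℝ) f x) (A.dSrc_leftRep x (X.1 x))))

/-- The chain rule for `inv`, which carries `(-X)^L` to `X^R`; the sign found here turns the
difference `X^L - X^R` into a sum in the duality formula. -/
theorem dirDeriv_left_comp_inv (X : A.Sec) {f : G → ℝ} (hf : ContMDiff 𝓘(ℝ, EG) 𝓘(ℝ, ℝ) ∞ f)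
    (g : G) : dirDeriv (A.left X) (fun h => f (A.inv h)) g =
      -dirDeriv (A.right X) f (A.inv g) := by
  have h := mfderiv_comp g ((hf (A.inv g)).mdifferentiableAt (by simp)) (A.mdifferentiableAt_inv g)
  have h1 : dirDeriv (A.left X) (fun h => f (A.inv h)) g = mfderiv 𝓘(ℝ, EG) 𝓘(ℝ, ℝ) f (A.inv g)
      (mfderiv 𝓘(ℝ, EG) 𝓘(ℝ, EG) A.inv g (A.left X g)) := congrArg (fun L => L (A.left X g)) h
  rw [h1, dirDeriv, A.right_inv, left_neg, map_neg, map_neg]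
  exact (neg_neg (_ : ℝ)).symm

theorem dirDeriv_right_comp_inv (X : A.Sec) {f : G → ℝ} (hf : ContMDiff 𝓘(ℝ, EG) 𝓘(ℝ, ℝ) ∞ f)
    (g : G) : dirDeriv (A.right X) (fun h => f (A.inv h)) g =
      -dirDeriv (A.left X) f (A.inv g) := by
  have := A.dirDeriv_left_comp_inv X (hf.comp A.contMDiff_inv) (A.inv g)
  simp only [Function.comp_apply, A.inv_inv] at this
  rw [this, neg_neg]
  rfl

/-- Left- and right-invariant vector fields commute. -/
theorem dirDeriv_left_right_comm [IsManifold 𝓘(ℝ, EM) ∞ M] (Y Z : A.Sec) {f : G → ℝ}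
    (hf : ContMDiff 𝓘(ℝ, EG) 𝓘(ℝ, ℝ) ∞ f) :
    dirDeriv (A.left Y) (dirDeriv (A.right Z) f) = dirDeriv (A.right Z) (dirDeriv (A.left Y) f) := by
  funext g
  obtain ⟨k, hks, hkt, hk⟩ := A.exists_curve (A.src g) (Y.1 (A.src g))
  obtain ⟨h, hhs, hht, hh⟩ := A.exists_curve_right (A.tgt g) (Z.1 (A.tgt g))
  have hfd : ∀ q, MDifferentiableAt 𝓘(ℝ, EG) 𝓘(ℝ, ℝ) f q := fun q =>
    (hf q).mdifferentiableAt (by simp)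
  have h1 := hasDerivAt_dirDeriv (A.hasVelocity_mul_left Y rfl hk (.of_forall hkt))
    ((contMDiff_dirDeriv (A.contMDiff_right Z) hf g).mdifferentiableAt (by simp))
  have h2 := hasDerivAt_dirDeriv (A.hasVelocity_mul_right Z rfl hh (.of_forall hht))
    ((contMDiff_dirDeriv (A.contMDiff_left Y) hf g).mdifferentiableAt (by simp))
  -- Both orders of differentiation are iterated derivatives of `f (h(s) g k(t))`: left and right
  -- translations commute by associativity.
  let q : ℝ × ℝ → ℝ := fun z => f (A.mul (h z.1) (A.mul g (k z.2)))
  have hq : ContMDiffAt 𝓘(ℝ, ℝ × ℝ) 𝓘(ℝ, ℝ) ∞ q (0, 0) := by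
    refine ContMDiffAt.comp ((0 : ℝ), (0 : ℝ)) (hf _) (A.contMDiffAt_mul ?_
      (A.contMDiffAt_mul contMDiffAt_const ?_ (.of_forall fun z => (hkt _).symm))
      (.of_forall fun z => by rw [hht, A.tgt_mul _ _ (hkt _).symm]))
    · exact ContMDiffAt.comp ((0 : ℝ), (0 : ℝ)) (g := h) (f := Prod.fst) hhs
        contDiffAt_fst.contMDiffAt
    · exact ContMDiffAt.comp ((0 : ℝ), (0 : ℝ)) (g := k) (f := Prod.snd) hks
        contDiffAt_snd.contMDiffAt
  -- All points `g k(t)` have the target of `g`, so the single curve `h` computes `Z^R` at each of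
  -- them; likewise `k` serves all points `h(s) g`, which share the source of `g`.
  have e1 : (fun t => dirDeriv (A.right Z) f (A.mul g (k t))) =
      fun t => deriv (fun s => q (s, t)) 0 := by
    funext t
    exact (hasDerivAt_dirDeriv (A.hasVelocity_mul_right Z (A.tgt_mul _ _ (hkt t).symm) hh
      (.of_forall hht)) (hfd _)).deriv.symm
  have e2 : (fun s => dirDeriv (A.left Y) f (A.mul (h s) g)) =
      fun s => deriv (fun t => q (s, t)) 0 := by
    funext s
    refine ((hasDerivAt_dirDeriv (A.hasVelocity_mul_left Y (A.src_mul _ _ (hht s)) hk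
      (.of_forall hkt)) (hfd _)).deriv.symm).trans ?_
    congr 1
    funext t
    exact congrArg f (A.mul_assoc _ _ _ (hht s) (hkt t).symm)
  rw [e1] at h1
  rw [e2] at h2
  rw [← h1.deriv, ← h2.deriv]
  exact ContDiffAt.deriv_deriv_comm (hq.contDiffAt.of_le (by norm_cast))

end LieGroupoid

/-! ### The Lie bracket as a commutator. -/

namespace LieGroupoid

variable {EG : Type*} [NormedAddCommGroup EG] [NormedSpace ℝ EG]
  {G : Type*} [TopologicalSpace G] [ChartedSpace EG G] [IsManifold 𝓘(ℝ, EG) ∞ G]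

/-- The Lie bracket of vector fields acts on functions as the commutator. -/
theorem dirDeriv_mlieBracket [CompleteSpace EG] {V W : ∀ g : G, TangentSpace 𝓘(ℝ, EG) g}
    (hV : ContMDiff 𝓘(ℝ, EG) (𝓘(ℝ, EG).prod 𝓘(ℝ, EG)) ∞
      (fun g => (⟨g, V g⟩ : TangentBundle 𝓘(ℝ, EG) G)))
    (hW : ContMDiff 𝓘(ℝ, EG) (𝓘(ℝ, EG).prod 𝓘(ℝ, EG)) ∞
      (fun g => (⟨g, W g⟩ : TangentBundle 𝓘(ℝ, EG) G))) {f : G → ℝ}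
    (hf : ContMDiff 𝓘(ℝ, EG) 𝓘(ℝ, ℝ) ∞ f) (p : G) :
    dirDeriv (VectorField.mlieBracket 𝓘(ℝ, EG) V W) f p =
      dirDeriv V (dirDeriv W f) p - dirDeriv W (dirDeriv V f) p := by
  have : IsManifold 𝓘(ℝ, EG) 1 G := .of_le (n := ∞) (by norm_cast)
  have : IsManifold 𝓘(ℝ, EG) 2 G := .of_le (n := ∞) (by norm_cast)
  set φ := extChartAt 𝓘(ℝ, EG) p with hφ
  -- The coordinate expression of a vector field in the chart at `p`, written as in the definition
  -- of `mlieBracket`.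
  let T : (∀ g : G, TangentSpace 𝓘(ℝ, EG) g) → EG → EG := fun U z =>
    VectorField.mpullbackWithin 𝓘(ℝ, EG) 𝓘(ℝ, EG) φ.symm U (Set.range 𝓘(ℝ, EG)) z
  have hTd : ∀ U : ∀ g : G, TangentSpace 𝓘(ℝ, EG) g, ContMDiff 𝓘(ℝ, EG) (𝓘(ℝ, EG).prod 𝓘(ℝ, EG)) ∞
      (fun g => (⟨g, U g⟩ : TangentBundle 𝓘(ℝ, EG) G)) → DifferentiableAt ℝ (T U) (φ p) := by
    intro U hU
    have := (hU p).mdifferentiableAt (by simp) |>.mdifferentiableWithinAt (s := Set.univ)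
      |>.differentiableWithinAt_mpullbackWithin_vectorField
    refine this.differentiableAt ?_
    rw [Set.preimage_univ, Set.univ_inter, ModelWithCorners.range_eq_univ]
    exact Filter.univ_mem
  have hdir : ∀ (U : ∀ g : G, TangentSpace 𝓘(ℝ, EG) g) (h : G → ℝ),
      ContMDiff 𝓘(ℝ, EG) 𝓘(ℝ, ℝ) ∞ h → ∀ z ∈ φ.target,
        dirDeriv U h (φ.symm z) = fderiv ℝ (h ∘ φ.symm) z (T U z) := by
    intro U h hh z hz
    have hs : MDifferentiableAt 𝓘(ℝ, EG) 𝓘(ℝ, EG) φ.symm z :=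
      ((contMDiffOn_extChartAt_symm (n := ∞) p).contMDiffAt
        ((isOpen_extChartAt_target p).mem_nhds hz)).mdifferentiableAt (by simp)
    have h1 := mfderiv_comp z ((hh (φ.symm z)).mdifferentiableAt (by simp)) hs
    rw [mfderiv_eq_fderiv] at h1
    rw [h1]
    have h2 := isInvertible_mfderivWithin_extChartAt_symm hz
    have h3 := h2.self_apply_inverse (U (φ.symm z))
    have h4 : mfderiv 𝓘(ℝ, EG) 𝓘(ℝ, EG) φ.symm z (T U z) = U (φ.symm z) := by
      have h5 : mfderivWithin 𝓘(ℝ, EG) 𝓘(ℝ, EG) φ.symm (Set.range 𝓘(ℝ, EG)) z =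
          mfderiv 𝓘(ℝ, EG) 𝓘(ℝ, EG) φ.symm z := by
        rw [ModelWithCorners.range_eq_univ, mfderivWithin_univ]
      rw [← h5]
      exact h3
    exact congrArg (mfderiv 𝓘(ℝ, EG) 𝓘(ℝ, ℝ) h (φ.symm z)) h4.symm
  have hft : ContDiffAt ℝ ∞ (f ∘ φ.symm) (φ p) :=
    (hf.comp_contMDiffOn (contMDiffOn_extChartAt_symm p)).contDiffOn.contDiffAt
      (extChartAt_target_mem_nhds p)
  have hf2 : DifferentiableAt ℝ (fderiv ℝ (f ∘ φ.symm)) (φ p) :=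
    (hft.fderiv_right (m := 1) (by norm_cast)).differentiableAt (by simp)
  have hpt : φ p ∈ φ.target := mem_extChartAt_target p
  have hpp : φ.symm (φ p) = p := extChartAt_to_inv p
  -- The Hessian term is symmetric and cancels in the commutator; the terms differentiating the
  -- coefficients form the coordinate bracket.
  have hsecond : ∀ U U' : ∀ g : G, TangentSpace 𝓘(ℝ, EG) g,
      ContMDiff 𝓘(ℝ, EG) (𝓘(ℝ, EG).prod 𝓘(ℝ, EG)) ∞
        (fun g => (⟨g, U' g⟩ : TangentBundle 𝓘(ℝ, EG) G)) →
      dirDeriv U (dirDeriv U' f) p =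
        fderiv ℝ (fderiv ℝ (f ∘ φ.symm)) (φ p) (T U (φ p)) (T U' (φ p)) +
          fderiv ℝ (f ∘ φ.symm) (φ p) (fderiv ℝ (T U') (φ p) (T U (φ p))) := by
    intro U U' hU'
    have h1 := hdir U (dirDeriv U' f) (contMDiff_dirDeriv hU' hf) (φ p) hpt
    rw [hpp] at h1
    have h2 : dirDeriv U' f ∘ φ.symm =ᶠ[𝓝 (φ p)] fun z => fderiv ℝ (f ∘ φ.symm) z (T U' z) := by
      filter_upwards [extChartAt_target_mem_nhds (I := 𝓘(ℝ, EG)) p] with z hz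
      exact hdir U' f hf z hz
    rw [h1, h2.fderiv_eq, (hf2.hasFDerivAt.clm_apply (hTd U' hU').hasFDerivAt).fderiv]
    simp [add_comm]
  have hφp : mfderiv 𝓘(ℝ, EG) 𝓘(ℝ, EG) φ p = ContinuousLinearMap.id ℝ _ :=
    mfderiv_extChartAt_self
  have hr : φ.symm ⁻¹' Set.univ ∩ Set.range 𝓘(ℝ, EG) = Set.univ := by
    rw [Set.preimage_univ, Set.univ_inter, ModelWithCorners.range_eq_univ]
  have hbr : VectorField.mlieBracket 𝓘(ℝ, EG) V W p =
      VectorField.lieBracket ℝ (E := EG) (T V) (T W) (φ p) := by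
    have h1 : VectorField.mlieBracket 𝓘(ℝ, EG) V W p = (mfderiv 𝓘(ℝ, EG) 𝓘(ℝ, EG) φ p).inverse
      (VectorField.lieBracketWithin ℝ (E := EG) (T V) (T W)
        (φ.symm ⁻¹' Set.univ ∩ Set.range 𝓘(ℝ, EG)) (φ p)) := rfl
    rw [h1, hφp, hr, VectorField.lieBracketWithin_univ]
    exact congrArg (fun L : EG →L[ℝ] EG => L (VectorField.lieBracket ℝ (T V) (T W) (φ p)))
      ContinuousLinearMap.inverse_id
  have h1 : dirDeriv (VectorField.mlieBracket 𝓘(ℝ, EG) V W) f p =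
      fderiv ℝ (f ∘ φ.symm) (φ p) (VectorField.mlieBracket 𝓘(ℝ, EG) V W p) := by
    have h2 : f =ᶠ[𝓝 p] (f ∘ φ.symm) ∘ φ := by
      filter_upwards [extChartAt_source_mem_nhds (I := 𝓘(ℝ, EG)) p] with q hq
      simp only [Function.comp_apply]
      rw [φ.left_inv hq]
    have h3 := mfderiv_comp p (hft.differentiableAt (by simp)).mdifferentiableAt
      (mdifferentiableAt_extChartAt (I := 𝓘(ℝ, EG)) (mem_chart_source EG p))
    rw [dirDeriv, h2.mfderiv_eq, h3, hφp, mfderiv_eq_fderiv]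
    rfl
  rw [h1, hsecond V W hW, hsecond W V hV, hbr, VectorField.lieBracket_eq, map_sub,
    ((hft.of_le (m := 2) (by norm_cast)).isSymmSndFDerivAt (by simp)).eq (T V (φ p)) (T W (φ p))]
  ring

end LieGroupoid

/-! ### The triple derivative `X^L Y^L Z^R F` and its symmetries. -/

namespace LieGroupoid

variable {EM : Type*} [NormedAddCommGroup EM] [NormedSpace ℝ EM]
  {EG : Type*} [NormedAddCommGroup EG] [NormedSpace ℝ EG]
  {M : Type*} [TopologicalSpace M] [ChartedSpace EM M] [IsManifold 𝓘(ℝ, EM) ∞ M]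
  {G : Type*} [TopologicalSpace G] [ChartedSpace EG G] [IsManifold 𝓘(ℝ, EG) ∞ G]
  {A : LieGroupoid EM EG M G}

omit [IsManifold 𝓘(ℝ, EM) ∞ M] in
theorem anchorDeriv_const (X : A.Sec) (c : ℝ) (x : M) : A.anchorDeriv X (fun _ => c) x = 0 := by
  have h : mfderiv 𝓘(ℝ, EM) 𝓘(ℝ, ℝ) (fun _ : M => c) x = 0 := mfderiv_const
  rw [anchorDeriv, h]
  rfl

theorem contMDiff_right_apply (Z : A.Sec) {f : G → ℝ} (hf : ContMDiff 𝓘(ℝ, EG) 𝓘(ℝ, ℝ) ∞ f) :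
    ContMDiff 𝓘(ℝ, EG) 𝓘(ℝ, ℝ) ∞ (dirDeriv (A.right Z) f) :=
  contMDiff_dirDeriv (A.contMDiff_right Z) hf

theorem contMDiff_left_apply (Z : A.Sec) {f : G → ℝ} (hf : ContMDiff 𝓘(ℝ, EG) 𝓘(ℝ, ℝ) ∞ f) :
    ContMDiff 𝓘(ℝ, EG) 𝓘(ℝ, ℝ) ∞ (dirDeriv (A.left Z) f) :=
  contMDiff_dirDeriv (A.contMDiff_left Z) hf

namespace ContrastFunction

section LeftLeftRight

variable {f : G → ℝ} (hf : ContMDiff 𝓘(ℝ, EG) 𝓘(ℝ, ℝ) ∞ f)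
include hf

theorem contMDiff_leftLeftRight (X Y Z : A.Sec) :
    ContMDiff 𝓘(ℝ, EM) 𝓘(ℝ, ℝ) ∞ (leftLeftRight X Y Z f) :=
  (contMDiff_left_apply X (contMDiff_left_apply Y (contMDiff_right_apply Z hf))).comp
    A.contMDiff_unit

omit hf [IsManifold 𝓘(ℝ, EM) ∞ M] in
theorem leftLeftRight_add_left (X X' Y Z : A.Sec) (x : M) :
    leftLeftRight (X + X') Y Z f x = leftLeftRight X Y Z f x + leftLeftRight X' Y Z f x := by
  rw [leftLeftRight, left_add]
  exact dirDeriv_add_left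

omit hf [IsManifold 𝓘(ℝ, EM) ∞ M] in
theorem leftLeftRight_fmul_left (h : C^∞⟮𝓘(ℝ, EM), M; 𝓘(ℝ, ℝ), ℝ⟯) (X Y Z : A.Sec) (x : M) :
    leftLeftRight (A.fmul h X) Y Z f x = h x * leftLeftRight X Y Z f x := by
  rw [leftLeftRight, left_fmul]
  refine (dirDeriv_smul_left _).trans ?_
  rw [A.src_unit]
  rfl

theorem leftLeftRight_add_mid (X Y Y' Z : A.Sec) (x : M) :
    leftLeftRight X (Y + Y') Z f x = leftLeftRight X Y Z f x + leftLeftRight X Y' Z f x := by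
  have h : dirDeriv (A.left (Y + Y')) (dirDeriv (A.right Z) f) =
      fun g => dirDeriv (A.left Y) (dirDeriv (A.right Z) f) g +
        dirDeriv (A.left Y') (dirDeriv (A.right Z) f) g := by
    funext g
    rw [left_add]
    exact dirDeriv_add_left
  rw [leftLeftRight, h]
  exact dirDeriv_add
    ((contMDiff_left_apply Y (contMDiff_right_apply Z hf) _).mdifferentiableAt (by simp))
    ((contMDiff_left_apply Y' (contMDiff_right_apply Z hf) _).mdifferentiableAt (by simp))

/-- The factor becomes `h ∘ src`, which `X^L` differentiates to `α(X)h` on the units. -/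
theorem leftLeftRight_fmul_mid (h : C^∞⟮𝓘(ℝ, EM), M; 𝓘(ℝ, ℝ), ℝ⟯) (X Y Z : A.Sec) (x : M) :
    leftLeftRight X (A.fmul h Y) Z f x =
      A.anchorDeriv X h x * dirDeriv (A.left Y) (dirDeriv (A.right Z) f) (A.unit x) +
        h x * leftLeftRight X Y Z f x := by
  have e : dirDeriv (A.left (A.fmul h Y)) (dirDeriv (A.right Z) f) =
      fun g => h (A.src g) * dirDeriv (A.left Y) (dirDeriv (A.right Z) f) g := by
    funext g
    rw [left_fmul]
    exact dirDeriv_smul_left (fun g => h (A.src g))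
  rw [leftLeftRight, e, dirDeriv_mul (f := fun g => h (A.src g))
    ((h.contMDiff.comp A.contMDiff_src _).mdifferentiableAt (by simp))
    ((contMDiff_left_apply Y (contMDiff_right_apply Z hf) _).mdifferentiableAt (by simp)),
    A.dirDeriv_left_comp_src X h.contMDiff, A.src_unit]
  rfl

theorem leftLeftRight_add_right (X Y Z Z' : A.Sec) (x : M) :
    leftLeftRight X Y (Z + Z') f x = leftLeftRight X Y Z f x + leftLeftRight X Y Z' f x := by
  have h : dirDeriv (A.right (Z + Z')) f =
      fun g => dirDeriv (A.right Z) f g + dirDeriv (A.right Z') f g := by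
    funext g
    rw [right_add]
    exact dirDeriv_add_left
  have h' : dirDeriv (A.left Y) (dirDeriv (A.right (Z + Z')) f) =
      fun g => dirDeriv (A.left Y) (dirDeriv (A.right Z) f) g +
        dirDeriv (A.left Y) (dirDeriv (A.right Z') f) g := by
    funext g
    rw [h]
    exact dirDeriv_add ((contMDiff_right_apply Z hf _).mdifferentiableAt (by simp))
      ((contMDiff_right_apply Z' hf _).mdifferentiableAt (by simp))
  rw [leftLeftRight, h']
  exact dirDeriv_add
    ((contMDiff_left_apply Y (contMDiff_right_apply Z hf) _).mdifferentiableAt (by simp))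
    ((contMDiff_left_apply Y (contMDiff_right_apply Z' hf) _).mdifferentiableAt (by simp))

/-- The factor becomes `h ∘ tgt`, a constant for both left-invariant fields. Taking the third field
right-invariant is thus what makes a one-form in `Z`. -/
theorem leftLeftRight_fmul_right (h : C^∞⟮𝓘(ℝ, EM), M; 𝓘(ℝ, ℝ), ℝ⟯) (X Y Z : A.Sec) (x : M) :
    leftLeftRight X Y (A.fmul h Z) f x = h x * leftLeftRight X Y Z f x := by
  have key : ∀ (W : A.Sec) {k : G → ℝ}, ContMDiff 𝓘(ℝ, EG) 𝓘(ℝ, ℝ) ∞ k →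
      dirDeriv (A.left W) (fun g => h (A.tgt g) * k g) =
        fun g => h (A.tgt g) * dirDeriv (A.left W) k g := by
    intro W k hk
    funext g
    rw [dirDeriv_mul (f := fun g => h (A.tgt g))
      ((h.contMDiff.comp A.contMDiff_tgt _).mdifferentiableAt (by simp))
      ((hk _).mdifferentiableAt (by simp)), A.dirDeriv_left_comp_tgt W h.contMDiff, zero_mul,
      zero_add]
  have e : dirDeriv (A.right (A.fmul h Z)) f = fun g => h (A.tgt g) * dirDeriv (A.right Z) f g := by
    funext g
    rw [right_fmul]
    exact dirDeriv_smul_left (fun g => h (A.tgt g))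
  rw [leftLeftRight, e, key Y (contMDiff_right_apply Z hf),
    key X (contMDiff_left_apply Y (contMDiff_right_apply Z hf))]
  change h (A.tgt (A.unit x)) * _ = _
  rw [A.tgt_unit]
  rfl

/-- Duality of the triple derivative of an inversion-invariant function. -/
theorem leftLeftRight_add_swap (hdual : ∀ g, f (A.inv g) = f g) (X Y Z : A.Sec) (x : M) :
    A.anchorDeriv X (fun y => dirDeriv (A.left Y) (dirDeriv (A.right Z) f) (A.unit y)) x =
      leftLeftRight X Y Z f x + leftLeftRight X Z Y f x := by
  have hr := contMDiff_right_apply Y hf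
  have hlr := contMDiff_left_apply Z hr
  have e1 : dirDeriv (A.left Y) f = fun g => -dirDeriv (A.right Y) f (A.inv g) := by
    funext g
    rw [← A.dirDeriv_left_comp_inv Y hf]
    simp only [hdual]
  have e2 : dirDeriv (A.right Z) (dirDeriv (A.left Y) f) =
      fun g => dirDeriv (A.left Z) (dirDeriv (A.right Y) f) (A.inv g) := by
    funext g
    rw [e1, dirDeriv_neg (f := fun g => dirDeriv (A.right Y) f (A.inv g))
      (((hr.comp A.contMDiff_inv) g).mdifferentiableAt (by simp)),
      A.dirDeriv_right_comp_inv Z hr, neg_neg]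
  -- With `α(X) = X^L - X^R`, the right-invariant term differentiates a function of `inv g` by `e2`,
  -- so it equals minus the triple derivative with `Y` and `Z` exchanged. In the other term the
  -- rewriting by `e2` is undone.
  rw [A.anchorDeriv_comp_unit X (contMDiff_left_apply Y (contMDiff_right_apply Z hf)),
    A.dirDeriv_left_right_comm Y Z hf, e2, A.dirDeriv_right_comp_inv X hlr, A.inv_unit, ← e2,
    ← A.dirDeriv_left_right_comm Y Z hf, sub_neg_eq_add]
  rfl

end LeftLeftRight

variable (F : A.ContrastFunction)

/-- The Hessian at a unit sees only classes modulo TM, so one left and one right representative may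
be used. In this mixed form the metric can be differentiated by commuting left and right fields. -/
theorem metric_eq (X Y : A.Sec) (x : M) : F.metric.form x (X.1 x) (Y.1 x) =
    dirDeriv (A.left X) (dirDeriv (A.right Y) F.toFun) (A.unit x) := by
  rw [← F.metric_toFiber x (A.left X) (A.right Y)
    ((A.contMDiff_right Y _).mdifferentiableAt (by simp)), left_unit, right_unit, toFiber_leftRep,
    toFiber_rightRep]

theorem contMDiff_metric (X Y : A.Sec) :
    ContMDiff 𝓘(ℝ, EM) 𝓘(ℝ, ℝ) ∞ (fun x => F.metric.form x (X.1 x) (Y.1 x)) := by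
  simp only [metric_eq]
  exact (contMDiff_left_apply X (contMDiff_right_apply Y F.contMDiff)).comp A.contMDiff_unit

theorem anchorDeriv_metric (hdual : ∀ g, F.toFun (A.inv g) = F.toFun g) (X Y Z : A.Sec) (x : M) :
    A.anchorDeriv X (fun y => F.metric.form y (Y.1 y) (Z.1 y)) x =
      leftLeftRight X Y Z F.toFun x + leftLeftRight X Z Y F.toFun x := by
  simp only [metric_eq]
  exact leftLeftRight_add_swap F.contMDiff hdual X Y Z x

/-- The field `[X^L, Y^L]` represents the bracket at the units and acts on `Z^R F` as a commutator.
This is torsion-freeness before passing to the quotient. -/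
theorem metric_bracket [CompleteSpace EG] (X Y Z : A.Sec) (x : M) :
    F.metric.form x (A.bracket X Y x) (Z.1 x) =
      leftLeftRight X Y Z F.toFun x - leftLeftRight Y X Z F.toFun x := by
  have h := F.metric_toFiber x (VectorField.mlieBracket 𝓘(ℝ, EG) (A.left X) (A.left Y)) (A.right Z)
    ((A.contMDiff_right Z _).mdifferentiableAt (by simp))
  rw [right_unit, toFiber_rightRep] at h
  rw [bracket, h, dirDeriv_mlieBracket (A.contMDiff_left X) (A.contMDiff_left Y)
    (contMDiff_right_apply Z F.contMDiff)]
  rfl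

/-- In the duality formula g^F(Y,Z) is identically zero and the term with `Y` in the last slot
vanishes by the Koszul condition. Hence the triple derivative descends to classes of `Y`. -/
theorem leftLeftRight_mid_mem_kernel (hF : F.IsKoszul)
    (hdual : ∀ g, F.toFun (A.inv g) = F.toFun g) (X Y Z : A.Sec)
    (hY : ∀ x, Y.1 x ∈ F.metric.kernel x) (x : M) : leftLeftRight X Y Z F.toFun x = 0 := by
  have h := F.anchorDeriv_metric hdual X Y Z x
  have h0 : (fun y => F.metric.form y (Y.1 y) (Z.1 y)) = fun _ => (0 : ℝ) := by
    funext y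
    rw [show F.metric.form y (Y.1 y) = 0 from hY y, LinearMap.zero_apply]
  rw [h0, anchorDeriv_const, hF.vanish X Z Y hY, add_zero] at h
  exact h.symm

end ContrastFunction

end LieGroupoid

/-! ### Gram matrices of degenerate symmetric forms. -/

section LinearAlgebra

variable {ι : Type*} [Fintype ι] [DecidableEq ι] {V : Type*} [AddCommGroup V] [Module ℝ V]

/-- Vectors with nondegenerate Gram matrix whose number is the rank of a bilinear form detect its
kernel. -/
theorem LinearMap.BilinForm.mem_ker_of_gram [FiniteDimensional ℝ V] (B : LinearMap.BilinForm ℝ V)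
    (hB : ∀ v w, B v w = B w v) (X : ι → V) (hdet : (Matrix.of fun i j => B (X i) (X j)).det ≠ 0)
    (hcard : Fintype.card ι + Module.finrank ℝ (LinearMap.ker B) = Module.finrank ℝ V) {z : V}
    (hz : ∀ i, B (X i) z = 0) : z ∈ LinearMap.ker B := by
  set Γ := Matrix.of fun i j => B (X i) (X j) with hΓ
  -- `ker B` lies in the kernel of `L`; invertibility of the Gram matrix makes `L` surjective, and
  -- the dimension count forces equality.
  let L : V →ₗ[ℝ] ι → ℝ := LinearMap.pi fun i => B (X i)
  have hle : LinearMap.ker B ≤ LinearMap.ker L := by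
    intro v hv
    rw [LinearMap.mem_ker] at hv ⊢
    funext i
    change B (X i) v = 0
    rw [hB, hv, LinearMap.zero_apply]
  have hsurj : Function.Surjective L := by
    intro y
    refine ⟨∑ j, (Γ⁻¹.mulVec y) j • X j, ?_⟩
    have h1 : Γ.mulVec (Γ⁻¹.mulVec y) = y := by
      rw [Matrix.mulVec_mulVec, Matrix.mul_nonsing_inv _ (Ne.isUnit hdet), Matrix.one_mulVec]
    funext i
    rw [← congrFun h1 i]
    change B (X i) _ = _
    simp only [map_sum, map_smul, smul_eq_mul]
    rw [Matrix.mulVec, dotProduct]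
    exact Finset.sum_congr rfl fun j _ => mul_comm _ _
  have hrank := LinearMap.finrank_range_add_finrank_ker L
  rw [LinearMap.range_eq_top.2 hsurj, finrank_top, Module.finrank_fintype_fun_eq_card] at hrank
  have heq : LinearMap.ker B = LinearMap.ker L :=
    Submodule.eq_of_le_of_finrank_eq hle (by omega)
  rw [heq, LinearMap.mem_ker]
  funext i
  exact hz i

/-- The Gram matrix of a basis of a complement of the kernel is nondegenerate. -/
theorem LinearMap.BilinForm.det_gram_ne_zero (B : LinearMap.BilinForm ℝ V)
    (hB : ∀ v w, B v w = B w v) {S : Submodule ℝ V} (hS : IsCompl S (LinearMap.ker B))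
    (e : Module.Basis ι ℝ S) : (Matrix.of fun i j => B (e i) (e j)).det ≠ 0 := by
  intro h0
  obtain ⟨c, hc, hc0⟩ := Matrix.exists_mulVec_eq_zero_iff.2 h0
  apply hc
  -- A null vector of the Gram matrix gives an element of `S` orthogonal to `S`, hence to
  -- everything, hence in the intersection of `S` with the kernel.
  set s : S := ∑ j, c j • e j with hs
  have h1 : ∀ i, B (e i) s = 0 := by
    intro i
    have := congrFun hc0 i
    rw [Matrix.mulVec, dotProduct] at this
    rw [← show _ = (0 : ℝ) from this, hs]
    simp only [Submodule.coe_sum, Submodule.coe_smul, map_sum, map_smul, smul_eq_mul,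
      Matrix.of_apply]
    exact Finset.sum_congr rfl fun j _ => mul_comm _ _
  have h2 : ∀ t : S, B t s = 0 := by
    intro t
    rw [← e.sum_repr t, Submodule.coe_sum, map_sum, LinearMap.sum_apply]
    exact Finset.sum_eq_zero fun i _ => by
      rw [Submodule.coe_smul, map_smul, LinearMap.smul_apply, h1, smul_zero]
  have h3 : (s : V) ∈ LinearMap.ker B := by
    rw [LinearMap.mem_ker]
    ext v
    obtain ⟨t, ht, k, hk, rfl⟩ := Submodule.mem_sup.1 (hS.sup_eq_top ▸ Submodule.mem_top (x := v))
    rw [LinearMap.zero_apply, hB, map_add, LinearMap.add_apply, h2 ⟨t, ht⟩, LinearMap.mem_ker.1 hk,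
      LinearMap.zero_apply, add_zero]
  have h4 : s = 0 := Subtype.ext ((Submodule.disjoint_def.1 hS.disjoint) _ s.2 h3)
  funext i
  have := e.repr_sum_self c
  rw [← hs, h4, map_zero] at this
  exact (congrFun this i).symm

end LinearAlgebra

/-! ### Smooth matrix inverses, germs and cutoffs. -/

section Smooth

variable {E : Type*} [NormedAddCommGroup E] [NormedSpace ℝ E]
  {M : Type*} [TopologicalSpace M] [ChartedSpace E M] {ι : Type*} [Fintype ι] [DecidableEq ι]

theorem contMDiffAt_det {Γ : M → Matrix ι ι ℝ} {x : M}
    (h : ∀ i j, ContMDiffAt 𝓘(ℝ, E) 𝓘(ℝ, ℝ) ∞ (fun y => Γ y i j) x) :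
    ContMDiffAt 𝓘(ℝ, E) 𝓘(ℝ, ℝ) ∞ (fun y => (Γ y).det) x := by
  simp only [Matrix.det_apply]
  refine contMDiffAt_finsetSum fun σ _ => ?_
  have h1 : ContMDiffAt 𝓘(ℝ, E) 𝓘(ℝ, ℝ) ∞ (fun y => ∏ i, Γ y (σ i) i) x :=
    contMDiffAt_finsetProd fun i _ => h _ _
  have h2 : (fun y => Equiv.Perm.sign σ • ∏ i, Γ y (σ i) i) =
      fun y => ((Equiv.Perm.sign σ : ℤ) : ℝ) * ∏ i, Γ y (σ i) i := by
    funext y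
    rw [Units.smul_def, zsmul_eq_mul]
  rw [h2]
  exact contMDiffAt_const.mul h1

/-- Cramer's rule: an entry of the inverse is a quotient of determinants. -/
theorem contMDiffAt_matrix_inv {Γ : M → Matrix ι ι ℝ} {x : M}
    (h : ∀ i j, ContMDiffAt 𝓘(ℝ, E) 𝓘(ℝ, ℝ) ∞ (fun y => Γ y i j) x) (hx : (Γ x).det ≠ 0) (i j : ι) :
    ContMDiffAt 𝓘(ℝ, E) 𝓘(ℝ, ℝ) ∞ (fun y => (Γ y)⁻¹ i j) x := by
  have h1 : (fun y => (Γ y)⁻¹ i j) = fun y => ((Γ y).det)⁻¹ *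
      ((Γ y).updateRow j (Pi.single i 1)).det := by
    funext y
    rw [Matrix.inv_def, Matrix.smul_apply, Ring.inverse_eq_inv', smul_eq_mul, Matrix.adjugate_apply]
  rw [h1]
  refine ContMDiffAt.mul (((contDiffAt_inv ℝ hx).contMDiffAt).comp x (contMDiffAt_det h))
    (contMDiffAt_det fun k l => ?_)
  by_cases hk : k = j
  · subst hk
    simpa using contMDiffAt_const
  · simpa [Matrix.updateRow_ne hk] using h k l

variable [FiniteDimensional ℝ E] [IsManifold 𝓘(ℝ, E) ∞ M] [T2Space M]

/-- Every germ of a smooth function at a point extends to a smooth function. -/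
theorem exists_contMDiffMap_eventuallyEq {c : M → ℝ} {x : M}
    (hc : ∀ᶠ y in 𝓝 x, ContMDiffAt 𝓘(ℝ, E) 𝓘(ℝ, ℝ) ∞ c y) :
    ∃ c' : C^∞⟮𝓘(ℝ, E), M; 𝓘(ℝ, ℝ), ℝ⟯, ∀ᶠ y in 𝓝 x, c' y = c y := by
  obtain ⟨χ, -, hχ⟩ := (SmoothBumpFunction.nhds_basis_tsupport (I := 𝓘(ℝ, E)) x).mem_iff.1 hc
  refine ⟨⟨fun y => χ y * c y, contMDiff_of_tsupport fun y hy => ?_⟩, ?_⟩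
  · exact (χ.contMDiff y).mul (hχ (tsupport_mul_subset_left hy))
  · filter_upwards [χ.eventuallyEq_one] with y hy
    change χ y * c y = c y
    rw [hy, Pi.one_apply, one_mul]

/-- Every neighbourhood of a point supports a smooth function with value `1` at this point. -/
theorem exists_contMDiffMap_support {x : M} {U : Set M} (hU : U ∈ 𝓝 x) :
    ∃ χ : C^∞⟮𝓘(ℝ, E), M; 𝓘(ℝ, ℝ), ℝ⟯, χ x = 1 ∧ ∀ y, χ y ≠ 0 → y ∈ U := by
  obtain ⟨χ, -, hχ⟩ := (SmoothBumpFunction.nhds_basis_tsupport (I := 𝓘(ℝ, E)) x).mem_iff.1 hU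
  exact ⟨⟨χ, χ.contMDiff⟩, χ.eq_one, fun y hy => hχ (subset_tsupport _ hy)⟩

end Smooth

/-! ### Extending and patching sections of the Lie algebroid. -/

namespace LieGroupoid

variable {EM : Type*} [NormedAddCommGroup EM] [NormedSpace ℝ EM] [FiniteDimensional ℝ EM]
  {EG : Type*} [NormedAddCommGroup EG] [NormedSpace ℝ EG]
  {M : Type*} [TopologicalSpace M] [ChartedSpace EM M] [IsManifold 𝓘(ℝ, EM) ∞ M] [T2Space M]
  {G : Type*} [TopologicalSpace G] [ChartedSpace EG G] [IsManifold 𝓘(ℝ, EG) ∞ G]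
  (A : LieGroupoid EM EG M G)

/-- Every element of a fibre extends to a smooth section. -/
theorem exists_sec (x : M) (e : A.Fiber x) : ∃ X : A.Sec, X.1 x = e := by
  obtain ⟨v, rfl⟩ := A.toFiber_surjective x e
  set t := trivializationAt EG (TangentSpace 𝓘(ℝ, EG)) (A.unit x) with ht
  have hx : A.unit x ∈ t.baseSet := FiberBundle.mem_baseSet_trivializationAt' _
  have hU : A.unit ⁻¹' t.baseSet ∈ 𝓝 x :=
    A.contMDiff_unit.continuous.continuousAt.preimage_mem_nhds (t.open_baseSet.mem_nhds hx)
  obtain ⟨χ, -, hχ⟩ := (SmoothBumpFunction.nhds_basis_tsupport (I := 𝓘(ℝ, EM)) x).mem_iff.1 hU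
  -- Constant coordinates in a trivialization, cut off by `χ`. What `symmL` does off the base set is
  -- immaterial, since its argument is zero there.
  let V : ∀ y, TangentSpace 𝓘(ℝ, EG) (A.unit y) := fun y =>
    t.symmL ℝ (A.unit y) (χ y • t.continuousLinearMapAt ℝ (A.unit x) v)
  have hV : A.IsSmoothAlong V := by
    intro y
    by_cases hy : y ∈ tsupport χ
    · have hyU : A.unit y ∈ t.baseSet := hχ hy
      have h1 : ContMDiffAt 𝓘(ℝ, EM) (𝓘(ℝ, EG).prod 𝓘(ℝ, EG)) ∞
          (fun z => (A.unit z, χ z • t.continuousLinearMapAt ℝ (A.unit x) v)) y :=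
        (A.contMDiff_unit y).prodMk ((χ.contMDiff y).smul contMDiffAt_const)
      have h2 := (t.contMDiffOn_symm (n := ∞) (IB := 𝓘(ℝ, EG))).contMDiffAt
        (t.open_target.mem_nhds ((t.mem_target (x :=
          (A.unit y, χ y • t.continuousLinearMapAt ℝ (A.unit x) v))).2 hyU))
      refine (ContMDiffAt.comp y h2 h1).congr_of_eventuallyEq ?_
      have hev : ∀ᶠ z in 𝓝 y, A.unit z ∈ t.baseSet :=
        A.contMDiff_unit.continuous.continuousAt.eventually (t.open_baseSet.mem_nhds hyU)
      filter_upwards [hev] with z hz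
      refine Eq.trans ?_ (t.mk_symm hz (χ z • t.continuousLinearMapAt ℝ (A.unit x) v))
      exact congrArg _ (t.symmL_apply hz _)
    · refine (A.isSmoothAlong_zero y).congr_of_eventuallyEq ?_
      filter_upwards [(isClosed_tsupport χ).isOpen_compl.mem_nhds hy] with z hz
      have : χ z = 0 := image_eq_zero_of_notMem_tsupport hz
      simp [V, this]
  refine ⟨⟨fun y => A.toFiber y (V y), V, hV, fun _ => rfl⟩, ?_⟩
  change A.toFiber x (V x) = _
  simp only [V, χ.eq_one, one_smul]
  rw [t.symmL_continuousLinearMapAt hx]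

variable {A}

/-- A section of a bundle of convex sets is obtained by patching local sections. -/
theorem exists_sec_forall_mem_convex [SigmaCompactSpace M] {S : ∀ x, Set (A.Fiber x)}
    (hS : ∀ x, Convex ℝ (S x)) (h : ∀ x, ∃ W : A.Sec, ∀ᶠ y in 𝓝 x, W.1 y ∈ S y) :
    ∃ W : A.Sec, ∀ x, W.1 x ∈ S x := by
  choose W hW using h
  obtain ⟨ρ, hρ⟩ := SmoothPartitionOfUnity.exists_isSubordinate 𝓘(ℝ, EM) (s := Set.univ)
    isClosed_univ (fun x => interior {y | (W x).1 y ∈ S y}) (fun x => isOpen_interior)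
    (fun x _ => Set.mem_iUnion.2 ⟨x, mem_interior_iff_mem_nhds.2 (hW x)⟩)
  -- The partition of unity acts on representatives along the units, because smoothness of a section
  -- is defined through them.
  choose V hV hVW using fun x => (W x).2
  have hfin : ∀ y, (Function.support fun i => ρ i y).Finite := ρ.locallyFinite.point_finite
  have hfin' : ∀ y, (Function.support fun i => ρ i y • V i y).Finite := fun y =>
    (hfin y).subset (Function.support_smul_subset_left _ _)
  let T : ∀ y, TangentSpace 𝓘(ℝ, EG) (A.unit y) := fun y => ∑ᶠ i, ρ i y • V i y
  have hT : A.IsSmoothAlong T := by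
    rw [isSmoothAlong_iff]
    intro x₀
    have h1 := ρ.contMDiffAt_finsum (n := ⊤) (x₀ := x₀) (g := fun i x =>
      (trivializationAt EG (TangentSpace 𝓘(ℝ, EG)) (A.unit x₀)).linearMapAt ℝ (A.unit x) (V i x))
      (fun i _ => (A.isSmoothAlong_iff _).1 (hV i) x₀)
    refine h1.congr_of_eventuallyEq (.of_forall fun y => ?_)
    refine (map_finsum _ (hfin' y)).trans (finsum_congr fun i => ?_)
    rw [map_smul]
  have hTS : ∀ y, A.toFiber y (T y) = ∑ᶠ i, ρ i y • (W i).1 y := by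
    intro y
    refine (map_finsum _ (hfin' y)).trans (finsum_congr fun i => ?_)
    rw [map_smul, hVW]
  refine ⟨⟨fun y => A.toFiber y (T y), T, hT, fun _ => rfl⟩, fun y => ?_⟩
  change A.toFiber y (T y) ∈ S y
  rw [hTS]
  refine (hS y).finsum_mem (fun i => ρ.nonneg i y) (ρ.sum_eq_one (Set.mem_univ y)) fun i hi => ?_
  have h2 : y ∈ interior {y | (W i).1 y ∈ S y} := hρ i (subset_tsupport _ hi)
  exact (interior_subset (s := {y | (W i).1 y ∈ S y})) h2

end LieGroupoid

/-! ### Representing one-forms that vanish on the kernel. -/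

namespace LieGroupoid

variable {EM : Type*} [NormedAddCommGroup EM] [NormedSpace ℝ EM] [FiniteDimensional ℝ EM]
  {EG : Type*} [NormedAddCommGroup EG] [NormedSpace ℝ EG] [FiniteDimensional ℝ EG]
  {M : Type*} [TopologicalSpace M] [ChartedSpace EM M] [IsManifold 𝓘(ℝ, EM) ∞ M] [T2Space M]
  {G : Type*} [TopologicalSpace G] [ChartedSpace EG G] [IsManifold 𝓘(ℝ, EG) ∞ G]
  {A : LieGroupoid EM EG M G}

omit [IsManifold 𝓘(ℝ, EM) ∞ M] [T2Space M] [IsManifold 𝓘(ℝ, EG) ∞ G] [FiniteDimensional ℝ EM] in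
theorem finiteDimensional_fiber (A : LieGroupoid EM EG M G) (x : M) :
    FiniteDimensional ℝ (A.Fiber x) := by
  have : FiniteDimensional ℝ (TangentSpace 𝓘(ℝ, EG) (A.unit x)) :=
    inferInstanceAs (FiniteDimensional ℝ EG)
  infer_instance

omit [IsManifold 𝓘(ℝ, EM) ∞ M] [T2Space M] [IsManifold 𝓘(ℝ, EG) ∞ G] [FiniteDimensional ℝ EM] in
-- `dUnit` is injective with left inverse `dSrc`. So the rank of the algebroid is constant, and a
-- kernel of constant rank has complements of constant rank.
theorem finrank_fiber (A : LieGroupoid EM EG M G) (x : M) :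
    Module.finrank ℝ (A.Fiber x) + Module.finrank ℝ EM = Module.finrank ℝ EG := by
  have : FiniteDimensional ℝ (TangentSpace 𝓘(ℝ, EG) (A.unit x)) :=
    inferInstanceAs (FiniteDimensional ℝ EG)
  have h1 := Submodule.finrank_quotient_add_finrank (LinearMap.range (A.dUnit x))
  rw [LinearMap.finrank_range_of_inj
    (Function.LeftInverse.injective (g := A.dSrc x) (A.dSrc_dUnit x))] at h1
  exact h1

omit [FiniteDimensional ℝ EM] [FiniteDimensional ℝ EG] [IsManifold 𝓘(ℝ, EM) ∞ M] [T2Space M] in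
theorem sum_fmul_apply {ι : Type*} [Fintype ι] (c : ι → C^∞⟮𝓘(ℝ, EM), M; 𝓘(ℝ, ℝ), ℝ⟯)
    (X : ι → A.Sec) (x : M) :
    (∑ i, A.fmul (c i) (X i) : A.Sec).1 x = ∑ i, c i x • (X i).1 x := by
  rw [← Submodule.subtype_apply, map_sum, Finset.sum_apply]
  rfl

namespace SymForm

/-- Smooth one-forms on `Lie(G)`, as tensorial maps on sections. -/
structure IsTensorial (ψ : A.Sec → M → ℝ) : Prop where
  smooth : ∀ Z, ContMDiff 𝓘(ℝ, EM) 𝓘(ℝ, ℝ) ∞ (ψ Z)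
  add : ∀ Z Z' x, ψ (Z + Z') x = ψ Z x + ψ Z' x
  fmul : ∀ (f : C^∞⟮𝓘(ℝ, EM), M; 𝓘(ℝ, ℝ), ℝ⟯) Z x, ψ (A.fmul f Z) x = f x * ψ Z x

variable {b : A.SymForm}

/-- A frame of a complement of the kernel at a point determines one-forms vanishing on the kernel. -/
theorem IsTensorial.eq_sum_gram (hb : b.IsSemiRiemannian) {ψ : A.Sec → M → ℝ} (hψ : IsTensorial ψ)
    (hψK : ∀ Z : A.Sec, (∀ x, Z.1 x ∈ b.kernel x) → ∀ x, ψ Z x = 0)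
    {ι : Type*} [Fintype ι] [DecidableEq ι] (X : ι → A.Sec)
    (hcard : ∀ x, Fintype.card ι + Module.finrank ℝ (b.kernel x) = Module.finrank ℝ (A.Fiber x))
    {x : M} (hx : (Matrix.of fun i j => b.form x ((X i).1 x) ((X j).1 x)).det ≠ 0) (Z : A.Sec) :
    ψ Z x = ∑ j, ((Matrix.of fun i j => b.form x ((X i).1 x) ((X j).1 x))⁻¹.mulVec
      fun i => b.form x ((X i).1 x) (Z.1 x)) j * ψ (X j) x := by
  set Γ : M → Matrix ι ι ℝ := fun y => Matrix.of fun i j => b.form y ((X i).1 y) ((X j).1 y) with hΓ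
  have hΓs : ∀ y i j, ContMDiffAt 𝓘(ℝ, EM) 𝓘(ℝ, ℝ) ∞ (fun z => Γ z i j) y := fun y i j =>
    hb.smooth (X i) (X j) y
  have hdet : ∀ᶠ y in 𝓝 x, (Γ y).det ≠ 0 := (contMDiffAt_det (hΓs x)).continuousAt.eventually_ne hx
  -- The coefficients of `Z` modulo the kernel in the frame `X`, obtained by solving the Gram system
  -- near `x`.
  let a : ι → M → ℝ := fun j y => ((Γ y)⁻¹.mulVec fun i => b.form y ((X i).1 y) (Z.1 y)) j
  have ha : ∀ j, ∀ᶠ y in 𝓝 x, ContMDiffAt 𝓘(ℝ, EM) 𝓘(ℝ, ℝ) ∞ (a j) y := by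
    intro j
    filter_upwards [hdet] with y hy
    exact contMDiffAt_finsetSum fun i _ =>
      (contMDiffAt_matrix_inv (hΓs y) hy j i).mul (hb.smooth (X i) Z y)
  choose a' ha' using fun j => exists_contMDiffMap_eventuallyEq (ha j)
  obtain ⟨χ, hχx, hχ⟩ := exists_contMDiffMap_support (E := EM)
    (hdet.and (Filter.eventually_all.2 ha'))
  set S : A.Sec := ∑ j, A.fmul (a' j) (X j) with hS
  -- `ψ` is known to vanish only on global sections of the kernel; the cutoff makes the local
  -- difference global without changing it at `x`.
  have hK : ∀ y, (A.fmul χ (Z - S)).1 y ∈ b.kernel y := by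
    intro y
    change χ y • (Z.1 y - S.1 y) ∈ b.kernel y
    by_cases hy : χ y = 0
    · rw [hy, zero_smul]
      exact zero_mem _
    obtain ⟨hy1, hy2⟩ := hχ y hy
    refine Submodule.smul_mem _ _ ?_
    have := A.finiteDimensional_fiber y
    refine LinearMap.BilinForm.mem_ker_of_gram (b.form y) (b.symm y) (fun i => (X i).1 y) hy1
      (hcard y) fun i => ?_
    have h1 : (Γ y).mulVec (fun j => a j y) = fun i => b.form y ((X i).1 y) (Z.1 y) := by
      change (Γ y).mulVec ((Γ y)⁻¹.mulVec _) = _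
      rw [Matrix.mulVec_mulVec, Matrix.mul_nonsing_inv _ (Ne.isUnit hy1), Matrix.one_mulVec]
    rw [hS, sum_fmul_apply, map_sub, ← congrFun h1 i, sub_eq_zero, map_sum, Matrix.mulVec, dotProduct]
    refine Finset.sum_congr rfl fun j _ => ?_
    rw [map_smul, hy2 j, smul_eq_mul, mul_comm]
    rfl
  have h0 := hψK _ hK x
  have hsum : ψ S x = ∑ j, a' j x * ψ (X j) x := by
    have := map_sum (AddMonoidHom.mk' (fun Y => ψ Y x) fun Y Y' => hψ.add Y Y' x)
      (fun j => A.fmul (a' j) (X j)) Finset.univ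
    refine this.trans (Finset.sum_congr rfl fun j _ => ?_)
    exact hψ.fmul _ _ _
  have hsub := hψ.add (Z - S) S x
  rw [sub_add_cancel] at hsub
  rw [hψ.fmul, hχx, one_mul] at h0
  rw [hsub, h0, zero_add, hsum]
  refine Finset.sum_congr rfl fun j _ => ?_
  rw [(ha' j).self_of_nhds]

/-- Nondegeneracy of the transversal form: a one-form vanishing on the kernel is represented by a
section of a given family of subspaces that locally contains complements of the kernel. -/
theorem IsTensorial.exists_sec [SigmaCompactSpace M] (hb : b.IsSemiRiemannian)
    {ψ : A.Sec → M → ℝ} (hψ : IsTensorial ψ)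
    (hψK : ∀ Z : A.Sec, (∀ x, Z.1 x ∈ b.kernel x) → ∀ x, ψ Z x = 0)
    (C : ∀ x, Submodule ℝ (A.Fiber x)) (hC : ∀ x, ∃ S : Submodule ℝ (A.Fiber x),
      IsCompl S (b.kernel x) ∧ ∀ e ∈ S, ∃ X : A.Sec, X.1 x = e ∧ ∀ y, X.1 y ∈ C y) :
    ∃ W : A.Sec, (∀ x, W.1 x ∈ C x) ∧ ∀ Z x, b.form x (W.1 x) (Z.1 x) = ψ Z x := by
  classical
  suffices h : ∃ W : A.Sec, ∀ x,
      W.1 x ∈ {w : A.Fiber x | w ∈ C x ∧ ∀ Z : A.Sec, b.form x w (Z.1 x) = ψ Z x} by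
    obtain ⟨W, hW⟩ := h
    exact ⟨W, fun x => (hW x).1, fun Z x => (hW x).2 Z⟩
  refine exists_sec_forall_mem_convex (fun x => ?_) fun x => ?_
  -- Representing `ψ` inside `C x` is an affine condition, so its solutions form a convex set.
  · intro v hv w hw s t _ _ hst
    refine ⟨add_mem ((C x).smul_mem s hv.1) ((C x).smul_mem t hw.1), fun Z => ?_⟩
    rw [map_add, map_smul, map_smul, LinearMap.add_apply, LinearMap.smul_apply, LinearMap.smul_apply,
      hv.2, hw.2, ← add_smul, hst, one_smul]
  obtain ⟨S, hS, hSC⟩ := hC x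
  have := A.finiteDimensional_fiber x
  let e := Module.finBasis ℝ S
  choose X hX hXC using fun i => hSC (e i) (e i).2
  obtain ⟨r, hr⟩ := hb.constant_rank
  -- Constancy of both ranks gives the count at every `y`, so a frame chosen at `x` still works
  -- wherever its Gram determinant is nonzero.
  have hcard : ∀ y, Fintype.card (Fin (Module.finrank ℝ S)) + Module.finrank ℝ (b.kernel y) =
      Module.finrank ℝ (A.Fiber y) := by
    intro y
    have h1 := A.finrank_fiber x
    have h2 := A.finrank_fiber y
    have h3 := Submodule.finrank_add_eq_of_isCompl hS
    rw [hr] at h3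
    rw [Fintype.card_fin, hr]
    omega
  set Γ : M → Matrix (Fin (Module.finrank ℝ S)) (Fin (Module.finrank ℝ S)) ℝ := fun y =>
    Matrix.of fun i j => b.form y ((X i).1 y) ((X j).1 y) with hΓ
  have hΓs : ∀ y i j, ContMDiffAt 𝓘(ℝ, EM) 𝓘(ℝ, ℝ) ∞ (fun z => Γ z i j) y := fun y i j =>
    hb.smooth (X i) (X j) y
  have hx : (Γ x).det ≠ 0 := by
    have := (b.form x).det_gram_ne_zero (b.symm x) hS e
    simp only [hΓ, hX]
    exact this
  have hdet : ∀ᶠ y in 𝓝 x, (Γ y).det ≠ 0 := (contMDiffAt_det (hΓs x)).continuousAt.eventually_ne hx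
  -- The coefficient of `b(X i, Z)` when the expansion in `eq_sum_gram` is regrouped, whence the
  -- order of the indices.
  let c : Fin (Module.finrank ℝ S) → M → ℝ := fun i y => ∑ j, (Γ y)⁻¹ j i * ψ (X j) y
  have hc : ∀ i, ∀ᶠ y in 𝓝 x, ContMDiffAt 𝓘(ℝ, EM) 𝓘(ℝ, ℝ) ∞ (c i) y := by
    intro i
    filter_upwards [hdet] with y hy
    exact contMDiffAt_finsetSum fun j _ =>
      (contMDiffAt_matrix_inv (hΓs y) hy j i).mul (hψ.smooth (X j) y)
  choose c' hc' using fun i => exists_contMDiffMap_eventuallyEq (hc i)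
  refine ⟨∑ i, A.fmul (c' i) (X i), ?_⟩
  filter_upwards [hdet, Filter.eventually_all.2 hc'] with y hy1 hy2
  rw [sum_fmul_apply]
  refine ⟨Submodule.sum_mem _ fun i _ => Submodule.smul_mem _ _ (hXC i y), fun Z => ?_⟩
  rw [hψ.eq_sum_gram hb hψK X hcard hy1 Z]
  simp only [hy2, map_sum, LinearMap.sum_apply, map_smul, LinearMap.smul_apply, smul_eq_mul, c,
    Matrix.mulVec, dotProduct, Finset.sum_mul]
  rw [Finset.sum_comm]
  exact Finset.sum_congr rfl fun j _ => Finset.sum_congr rfl fun i _ => by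
    rw [mul_right_comm]

omit [FiniteDimensional ℝ EG] in
/-- Elements of the quotient by the kernel are determined by their products with sections. -/
theorem eq_of_transversal_eq {x : M} {u v : b.QuotFiber x}
    (h : ∀ Z : A.Sec, b.transversal x u ((b.bar Z).1 x) = b.transversal x v ((b.bar Z).1 x)) :
    u = v := by
  obtain ⟨e, rfl⟩ := Submodule.mkQ_surjective _ u
  obtain ⟨e', rfl⟩ := Submodule.mkQ_surjective _ v
  refine (Submodule.Quotient.eq _).2 ?_
  change b.form x (e - e') = 0
  refine LinearMap.ext fun w => ?_
  obtain ⟨Z, rfl⟩ := A.exists_sec x w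
  rw [map_sub, LinearMap.sub_apply, LinearMap.zero_apply, sub_eq_zero]
  exact h Z

omit [FiniteDimensional ℝ EM] [FiniteDimensional ℝ EG] [IsManifold 𝓘(ℝ, EM) ∞ M] [T2Space M] in
theorem exists_bar_eq (σ : b.QuotSec) : ∃ Y, b.bar Y = σ := by
  obtain ⟨_, Y, rfl⟩ := σ
  exact ⟨Y, rfl⟩

end SymForm

end LieGroupoid

/-! ### The Koszul connection and Koszul derivatives. -/

namespace LieGroupoid

variable {EM : Type*} [NormedAddCommGroup EM] [NormedSpace ℝ EM] [FiniteDimensional ℝ EM]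
  {EG : Type*} [NormedAddCommGroup EG] [NormedSpace ℝ EG] [FiniteDimensional ℝ EG]
  {M : Type*} [TopologicalSpace M] [ChartedSpace EM M] [IsManifold 𝓘(ℝ, EM) ∞ M] [T2Space M]
  {G : Type*} [TopologicalSpace G] [ChartedSpace EG G] [IsManifold 𝓘(ℝ, EG) ∞ G]
  {A : LieGroupoid EM EG M G}

namespace ContrastFunction

variable {F : A.ContrastFunction}

omit [FiniteDimensional ℝ EM] [FiniteDimensional ℝ EG] [T2Space M] in
theorem IsKoszul.isSemiRiemannian (hF : F.IsKoszul) : F.metric.IsSemiRiemannian :=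
  ⟨F.contMDiff_metric, hF.regular⟩

omit [FiniteDimensional ℝ EM] [FiniteDimensional ℝ EG] [IsManifold 𝓘(ℝ, EM) ∞ M] [T2Space M] in
theorem leftLeftRight_smul_left (c : ℝ) (X Y Z : A.Sec) (f : G → ℝ) (x : M) :
    leftLeftRight (c • X) Y Z f x = c * leftLeftRight X Y Z f x :=
  leftLeftRight_fmul_left (ContMDiffMap.const c) X Y Z x

omit [FiniteDimensional ℝ EM] [FiniteDimensional ℝ EG] [T2Space M] in
theorem leftLeftRight_smul_mid {f : G → ℝ} (hf : ContMDiff 𝓘(ℝ, EG) 𝓘(ℝ, ℝ) ∞ f) (c : ℝ)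
    (X Y Z : A.Sec) (x : M) : leftLeftRight X (c • Y) Z f x = c * leftLeftRight X Y Z f x := by
  refine (leftLeftRight_fmul_mid hf (ContMDiffMap.const c) X Y Z x).trans ?_
  have h : A.anchorDeriv X (ContMDiffMap.const c : C^∞⟮𝓘(ℝ, EM), M; 𝓘(ℝ, ℝ), ℝ⟯) x = 0 :=
    anchorDeriv_const X c x
  rw [h, zero_mul, zero_add]
  rfl

/-- The one-forms `X^L Y^L Z^R F` in `Z` are represented by sections of any complement of the
kernel. -/
theorem IsKoszul.exists_represents [SigmaCompactSpace M] (hF : F.IsKoszul)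
    (C : ∀ x, Submodule ℝ (A.Fiber x)) (hC : ∀ x, ∃ S, IsCompl S (F.metric.kernel x) ∧
      ∀ e ∈ S, ∃ X : A.Sec, X.1 x = e ∧ ∀ y, X.1 y ∈ C y) :
    ∃ D : A.Sec → A.Sec → A.Sec, (∀ X Y x, (D X Y).1 x ∈ C x) ∧ F.Represents D := by
  have h : ∀ X Y : A.Sec, ∃ W : A.Sec, (∀ x, W.1 x ∈ C x) ∧
      ∀ Z x, F.metric.form x (W.1 x) (Z.1 x) = leftLeftRight X Y Z F.toFun x := fun X Y =>
    SymForm.IsTensorial.exists_sec (ψ := fun Z => leftLeftRight X Y Z F.toFun)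
      hF.isSemiRiemannian
      ⟨contMDiff_leftLeftRight F.contMDiff X Y, leftLeftRight_add_right F.contMDiff X Y,
        fun f => leftLeftRight_fmul_right F.contMDiff f X Y⟩ (hF.vanish X Y) C hC
  choose D hDC hD using h
  exact ⟨D, hDC, hD⟩

omit [FiniteDimensional ℝ EM] [FiniteDimensional ℝ EG] [T2Space M] in
theorem leftLeftRight_congr_mid (hF : F.IsKoszul) (hdual : ∀ g, F.toFun (A.inv g) = F.toFun g)
    (X : A.Sec) {Y Y' : A.Sec} (h : F.metric.bar Y = F.metric.bar Y') (Z : A.Sec) (x : M) :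
    leftLeftRight X Y Z F.toFun x = leftLeftRight X Y' Z F.toFun x := by
  have hK : ∀ y, (Y - Y').1 y ∈ F.metric.kernel y := fun y =>
    (Submodule.Quotient.eq _).1 (congrFun (congrArg Subtype.val h) y)
  have h1 := leftLeftRight_add_mid F.contMDiff X (Y - Y') Y' Z x
  rwa [sub_add_cancel, F.leftLeftRight_mid_mem_kernel hF hdual X _ Z hK x, zero_add] at h1

theorem exists_isKoszulConnection [SigmaCompactSpace M] (hF : F.IsKoszul)
    (hdual : ∀ g, F.toFun (A.inv g) = F.toFun g) : ∃ nabla, F.IsKoszulConnection nabla := by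
  -- With no constraint on the values, a linear complement at each single point is enough; no smooth
  -- complementary subbundle is needed.
  obtain ⟨D, -, hD⟩ := hF.exists_represents (fun _ => ⊤) fun x => by
    obtain ⟨S, hS⟩ := Submodule.exists_isCompl (F.metric.kernel x)
    refine ⟨S, hS.symm, fun e _ => ?_⟩
    obtain ⟨X, hX⟩ := A.exists_sec x e
    exact ⟨X, hX, fun _ => Submodule.mem_top⟩
  -- An arbitrary representative of each class: the triple derivative does not depend on it.
  choose s hs using F.metric.exists_bar_eq
  refine ⟨fun X σ => F.metric.bar (D X (s σ)), fun X Y Z x => ?_⟩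
  exact (hD X (s (F.metric.bar Y)) Z x).trans (leftLeftRight_congr_mid hF hdual X (hs _) Z x)

omit [FiniteDimensional ℝ EG] in
/-- Sections of the quotient by the kernel are determined by their products with sections. -/
theorem quotSec_ext {b : A.SymForm} {σ τ : b.QuotSec}
    (h : ∀ (Z : A.Sec) x, b.transversal x (σ.1 x) ((b.bar Z).1 x) =
      b.transversal x (τ.1 x) ((b.bar Z).1 x)) : σ = τ :=
  Subtype.ext (funext fun x => SymForm.eq_of_transversal_eq fun Z => h Z x)

omit [FiniteDimensional ℝ EG] in
theorem IsKoszulConnection.unique {nabla nabla' : A.Sec → F.metric.QuotSec → F.metric.QuotSec}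
    (hn : F.IsKoszulConnection nabla) (hn' : F.IsKoszulConnection nabla') : nabla' = nabla := by
  funext X σ
  obtain ⟨Y, rfl⟩ := F.metric.exists_bar_eq σ
  exact quotSec_ext fun Z x => (hn' X Y Z x).trans (hn X Y Z x).symm

omit [FiniteDimensional ℝ EM] [FiniteDimensional ℝ EG] [IsManifold 𝓘(ℝ, EM) ∞ M] [T2Space M] in
theorem transversal_bar {b : A.SymForm} (X Y : A.Sec) (x : M) :
    b.transversal x ((b.bar X).1 x) ((b.bar Y).1 x) = b.form x (X.1 x) (Y.1 x) := rfl

omit [FiniteDimensional ℝ EM] [FiniteDimensional ℝ EG] [T2Space M] in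
theorem leftLeftRight_fmul_mid' (f : C^∞⟮𝓘(ℝ, EM), M; 𝓘(ℝ, ℝ), ℝ⟯) (X Y Z : A.Sec) (x : M) :
    leftLeftRight X (A.fmul f Y) Z F.toFun x =
      A.anchorDeriv X f x * F.metric.form x (Y.1 x) (Z.1 x) +
        f x * leftLeftRight X Y Z F.toFun x := by
  rw [leftLeftRight_fmul_mid F.contMDiff, metric_eq]

omit [FiniteDimensional ℝ EG] in
-- By nondegeneracy every axiom can be tested against sections `Z`, where it becomes the
-- corresponding rule for the triple derivative.
theorem IsKoszulConnection.isConnection {nabla : A.Sec → F.metric.QuotSec → F.metric.QuotSec}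
    (hn : F.IsKoszulConnection nabla) : F.metric.IsConnection nabla where
  add_left X X' σ := by
    obtain ⟨Y, rfl⟩ := F.metric.exists_bar_eq σ
    refine quotSec_ext fun Z x => ?_
    rw [hn, leftLeftRight_add_left, ← hn X, ← hn X', ← LinearMap.add_apply, ← map_add]
    rfl
  smul_left c X σ := by
    obtain ⟨Y, rfl⟩ := F.metric.exists_bar_eq σ
    refine quotSec_ext fun Z x => ?_
    rw [hn, leftLeftRight_smul_left, ← hn X, ← smul_eq_mul, ← LinearMap.smul_apply, ← map_smul]
    rfl
  add_right X σ τ := by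
    obtain ⟨Y, rfl⟩ := F.metric.exists_bar_eq σ
    obtain ⟨Y', rfl⟩ := F.metric.exists_bar_eq τ
    refine quotSec_ext fun Z x => ?_
    refine (hn X (Y + Y') Z x).trans ?_
    rw [leftLeftRight_add_mid F.contMDiff, ← hn X Y, ← hn X Y', ← LinearMap.add_apply, ← map_add]
    rfl
  smul_right c X σ := by
    obtain ⟨Y, rfl⟩ := F.metric.exists_bar_eq σ
    refine quotSec_ext fun Z x => ?_
    refine (hn X (c • Y) Z x).trans ?_
    rw [leftLeftRight_smul_mid F.contMDiff, ← hn X Y, ← smul_eq_mul, ← LinearMap.smul_apply,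
      ← map_smul]
    rfl
  tensorial f X σ := by
    obtain ⟨Y, rfl⟩ := F.metric.exists_bar_eq σ
    refine quotSec_ext fun Z x => ?_
    rw [hn, leftLeftRight_fmul_left, ← hn X, ← smul_eq_mul, ← LinearMap.smul_apply, ← map_smul]
    rfl
  leibniz f X σ x := by
    obtain ⟨Y, rfl⟩ := F.metric.exists_bar_eq σ
    refine SymForm.eq_of_transversal_eq fun Z => ?_
    refine (hn X (A.fmul f Y) Z x).trans ?_
    rw [leftLeftRight_fmul_mid', ← hn X Y, ← transversal_bar, add_comm, map_add,
      LinearMap.add_apply, map_smul, map_smul]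
    rfl

theorem IsKoszulConnection.isTransversalLeviCivita
    {nabla : A.Sec → F.metric.QuotSec → F.metric.QuotSec} (hn : F.IsKoszulConnection nabla)
    (hdual : ∀ g, F.toFun (A.inv g) = F.toFun g) : F.metric.IsTransversalLeviCivita nabla where
  isConnection := hn.isConnection
  torsionFree X Y x := by
    refine SymForm.eq_of_transversal_eq fun Z => ?_
    have := FiniteDimensional.complete ℝ EG
    refine Eq.trans ?_ (F.metric_bracket X Y Z x).symm
    rw [map_sub, LinearMap.sub_apply, hn, hn]
  selfDual X σ τ x := by
    obtain ⟨Y, rfl⟩ := F.metric.exists_bar_eq σ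
    obtain ⟨Z, rfl⟩ := F.metric.exists_bar_eq τ
    refine (F.anchorDeriv_metric hdual X Y Z x).trans ?_
    rw [← hn X Y, ← hn X Z]
    -- A representative is taken so that the symmetry of the form on the algebroid can swap the two
    -- slots.
    obtain ⟨W, hW⟩ := F.metric.exists_bar_eq (nabla X (F.metric.bar Z))
    rw [← hW, transversal_bar, transversal_bar, F.metric.symm]

omit [FiniteDimensional ℝ EM] [T2Space M] in
/-- Bilinear representatives of the Koszul connection are Koszul derivatives. -/
theorem Represents.isKoszulDerivative {D : A.Sec → A.Sec → A.Sec} (hD : F.Represents D)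
    (hdual : ∀ g, F.toFun (A.inv g) = F.toFun g)
    (add_left : ∀ X X' Y, D (X + X') Y = D X Y + D X' Y)
    (smul_left : ∀ (c : ℝ) X Y, D (c • X) Y = c • D X Y)
    (add_right : ∀ X Y Y', D X (Y + Y') = D X Y + D X Y')
    (smul_right : ∀ (c : ℝ) X Y, D X (c • Y) = c • D X Y) : F.metric.IsKoszulDerivative D where
  add_left := add_left
  smul_left := smul_left
  add_right := add_right
  smul_right := smul_right
  tensorial f X Z W x := by rw [hD, hD, leftLeftRight_fmul_left]
  leibniz f X Y W x := by rw [hD, hD, leftLeftRight_fmul_mid']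
  metric X Y Z x := by rw [F.anchorDeriv_metric hdual, F.metric.symm x (X.1 x), hD, hD]
  torsionFree X Y W x := by
    have := FiniteDimensional.complete ℝ EG
    rw [hD, hD, F.metric_bracket]

omit [FiniteDimensional ℝ EG] in
-- The difference lies in `C` and in the kernel, hence is zero. This gives both the uniqueness and
-- the bilinearity of `D`.
theorem sec_ext_of_mem {b : A.SymForm} {C : ∀ x, Submodule ℝ (A.Fiber x)}
    (hC : ∀ x, IsCompl (C x) (b.kernel x)) {V W : A.Sec} (hV : ∀ x, V.1 x ∈ C x)
    (hW : ∀ x, W.1 x ∈ C x)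
    (h : ∀ (Z : A.Sec) x, b.form x (V.1 x) (Z.1 x) = b.form x (W.1 x) (Z.1 x)) : V = W := by
  refine Subtype.ext (funext fun x => sub_eq_zero.1 ?_)
  refine (Submodule.disjoint_def.1 (hC x).disjoint) _ (sub_mem (hV x) (hW x)) ?_
  refine LinearMap.ext fun w => ?_
  obtain ⟨Z, rfl⟩ := A.exists_sec x w
  rw [map_sub, LinearMap.sub_apply, LinearMap.zero_apply, h, sub_self]

/-- Representatives of the Koszul connection in a complement of the kernel are Koszul
derivatives. -/
theorem Represents.isKoszulDerivative_of_mem {D : A.Sec → A.Sec → A.Sec} (hD : F.Represents D)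
    (hdual : ∀ g, F.toFun (A.inv g) = F.toFun g) {C : ∀ x, Submodule ℝ (A.Fiber x)}
    (hC : ∀ x, IsCompl (C x) (F.metric.kernel x)) (hDC : ∀ X Y x, (D X Y).1 x ∈ C x) :
    F.metric.IsKoszulDerivative D := by
  refine hD.isKoszulDerivative hdual (fun X X' Y => ?_) (fun c X Y => ?_) (fun X Y Y' => ?_)
    fun c X Y => ?_
  · refine sec_ext_of_mem hC (hDC _ _) (fun x => add_mem (hDC X Y x) (hDC X' Y x)) fun Z x => ?_
    rw [hD, leftLeftRight_add_left, ← hD X, ← hD X', ← LinearMap.add_apply, ← map_add]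
    rfl
  · refine sec_ext_of_mem hC (hDC _ _) (fun x => (C x).smul_mem c (hDC X Y x)) fun Z x => ?_
    rw [hD, leftLeftRight_smul_left, ← hD X, ← smul_eq_mul, ← LinearMap.smul_apply, ← map_smul]
    rfl
  · refine sec_ext_of_mem hC (hDC _ _) (fun x => add_mem (hDC X Y x) (hDC X Y' x)) fun Z x => ?_
    rw [hD, leftLeftRight_add_mid F.contMDiff, ← hD X Y, ← hD X Y', ← LinearMap.add_apply,
      ← map_add]
    rfl
  · refine sec_ext_of_mem hC (hDC _ _) (fun x => (C x).smul_mem c (hDC X Y x)) fun Z x => ?_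
    rw [hD, leftLeftRight_smul_mid F.contMDiff, ← hD X Y, ← smul_eq_mul, ← LinearMap.smul_apply,
      ← map_smul]
    rfl

/-- A linear map has a linear section over its range. -/
theorem exists_linear_section {V W : Type*} [AddCommGroup V] [Module ℝ V] [AddCommGroup W]
    [Module ℝ W] (L : V →ₗ[ℝ] W) : ∃ s : LinearMap.range L →ₗ[ℝ] V, ∀ σ, L (s σ) = σ := by
  obtain ⟨s, hs⟩ := L.rangeRestrict.exists_rightInverse_of_surjective L.range_rangeRestrict
  exact ⟨s, fun σ => congrArg Subtype.val (congrArg (fun T => T σ) hs)⟩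

/-- A linear choice of representatives turns the Koszul connection into a Koszul derivative. -/
theorem IsKoszulConnection.exists_isKoszulDerivative
    {nabla : A.Sec → F.metric.QuotSec → F.metric.QuotSec} (hn : F.IsKoszulConnection nabla)
    (hdual : ∀ g, F.toFun (A.inv g) = F.toFun g) : ∃ D, F.metric.IsKoszulDerivative D := by
  -- Linearity over ℝ suffices: a Koszul derivative has to respect multiplication by functions only
  -- after pairing with the form, where the kernel drops out.
  obtain ⟨s, hs⟩ := exists_linear_section F.metric.quotMap
  have hs' : ∀ σ : F.metric.QuotSec, F.metric.bar (s σ) = σ := fun σ => Subtype.ext (hs σ)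
  have hc := hn.isConnection
  refine ⟨fun X Y => s (nabla X (F.metric.bar Y)), Represents.isKoszulDerivative ?_ hdual ?_ ?_ ?_ ?_⟩
  · intro X Y Z x
    rw [← hn X Y Z x, ← transversal_bar, hs']
  · intro X X' Y
    rw [hc.add_left]
    exact map_add s _ _
  · intro c X Y
    rw [hc.smul_left]
    exact map_smul s _ _
  · intro X Y Y'
    exact (congrArg s (hc.add_right X (F.metric.bar Y) (F.metric.bar Y'))).trans (map_add s _ _)
  · intro c X Y
    exact (congrArg s (hc.smul_right c X (F.metric.bar Y))).trans (map_smul s _ _)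

end ContrastFunction

end LieGroupoid

/-! ### The theorem. -/

theorem mainTheorem6
    {EM : Type*} [NormedAddCommGroup EM] [NormedSpace ℝ EM] [FiniteDimensional ℝ EM]
    {EG : Type*} [NormedAddCommGroup EG] [NormedSpace ℝ EG] [FiniteDimensional ℝ EG]
    {M : Type*} [TopologicalSpace M] [ChartedSpace EM M] [IsManifold 𝓘(ℝ, EM) ∞ M]
    [T2Space M] [SigmaCompactSpace M]
    {G : Type*} [TopologicalSpace G] [ChartedSpace EG G] [IsManifold 𝓘(ℝ, EG) ∞ G]
    (A : LieGroupoid EM EG M G) (F : A.ContrastFunction) (hF : F.IsKoszul)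
    (hdual : ∀ g, F.toFun (A.inv g) = F.toFun g) :
    F.metric.IsSemiRiemannian ∧
    ∃ nabla : A.Sec → F.metric.QuotSec → F.metric.QuotSec,
      F.IsKoszulConnection nabla ∧
      (∀ nabla', F.IsKoszulConnection nabla' → nabla' = nabla) ∧
      F.metric.IsTransversalLeviCivita nabla ∧
      (∀ C : ∀ x, Submodule ℝ (A.Fiber x), A.IsSubbundle C →
        (∀ x, IsCompl (C x) (F.metric.kernel x)) →
        ∃ D : A.Sec → A.Sec → A.Sec,
          ((∀ X Y x, (D X Y).1 x ∈ C x) ∧ F.Represents D) ∧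
          (∀ D' : A.Sec → A.Sec → A.Sec,
            (∀ X Y x, (D' X Y).1 x ∈ C x) → F.Represents D' → D' = D) ∧
          F.metric.IsKoszulDerivative D ∧
          ∀ X Y, F.metric.bar (D X Y) = nabla X (F.metric.bar Y)) ∧
      ∃ D : A.Sec → A.Sec → A.Sec, F.metric.IsKoszulDerivative D := by
  obtain ⟨nabla, hn⟩ := LieGroupoid.ContrastFunction.exists_isKoszulConnection hF hdual
  refine ⟨hF.isSemiRiemannian, nabla, hn, fun _ hn' => hn.unique hn',
    hn.isTransversalLeviCivita hdual, fun C hC hCK => ?_, hn.exists_isKoszulDerivative hdual⟩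
  -- The fibre of `C` is its own local complement, and the subbundle property extends its elements
  -- to sections with values in `C`.
  obtain ⟨D, hDC, hD⟩ := hF.exists_represents C fun x => ⟨C x, hCK x, hC.exists_section x⟩
  refine ⟨D, ⟨hDC, hD⟩, fun D' hDC' hD' => ?_, hD.isKoszulDerivative_of_mem hdual hCK hDC,
    fun X Y => ?_⟩
  · funext X Y
    exact LieGroupoid.ContrastFunction.sec_ext_of_mem hCK (hDC' X Y) (hDC X Y) fun Z x =>
      (hD' X Y Z x).trans (hD X Y Z x).symm
  · exact LieGroupoid.ContrastFunction.quotSec_ext fun Z x =>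
      (hD X Y Z x).trans (hn X Y Z x).symm
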